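/- Let $\mathcal A$ be a finite alphabet with at least two letters and $\mathbf u=u_0u_1u_2\cdots$ an infinite word over $\mathcal A$ in which every letter of $\mathcal A$ occurs. Let $\mathcal L(\mathbf u)$ be the set of (finite, contiguous) factors of $\mathbf u$, $\mathcal L_n(\mathbf u)$ the set of those of length $n$, $\mathcal C(n)=\#\mathcal L_n(\mathbf u)$ and $\Delta\mathcal C(n)=\mathcal C(n+1)-\mathcal C(n)$. For $w\in\mathcal L(\mathbf u)$ put $\mathrm{Lext}(w)=\{a\in\mathcal A: aw\in\mathcal L(\mathbf u)\}$, $\mathrm{Rext}(w)=\{b\in\mathcal A: wb\in\mathcal L(\mathbf u)\}$, $\mathrm{Bext}(w)=\{awb\in\mathcal L(\mathbf u): a,b\in\mathcal A\}$ and $\mathrm b(w)=\#\mathrm{Bext}(w)-\#\mathrm{Lext}(w)-\#\mathrm{Rext}(w)+1$. The factor $w$ is left (right) special if $\#\mathrm{Lext}(w)\ge2$ ($\#\mathrm{Rext}(w)\ge 2$), special if it is left or right special, and bispecial if it is both. A map $\varphi:\mathcal A^*\to\mathcal A^*$ is a morphism (antimorphism) if $\varphi(vw)=\varphi(v)\varphi(w)$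 (respectively $\varphi(vw)=\varphi(w)\varphi(v)$) for all $v,w$. Let $G$ be a finite group, under composition, of morphisms and antimorphisms of $\mathcal A^*$ that contains at least one antimorphism, and let $G^{(2)}$ be the set of antimorphisms $\Theta\in G$ with $\Theta^2=\mathrm{Id}$. For an antimorphism $\Theta\in G$, a word $w$ is a $\Theta$-palindrome if $\Theta(w)=w$; it is a $G$-palindrome if it is a $\Theta$-palindrome for some antimorphism $\Theta\in G$. Let $\mathcal P_\Theta(n)$ be the number of $\Theta$-palindromes in $\mathcal L_n(\mathbf u)$, and for a $\Theta$-palindrome $w$ let $\mathrm{Pext}_\Theta(w)=\{a\in\mathcal A: aw\Theta(a)\in\mathcal L(\mathbf u)\}$. The language of $\mathbf u$ is closed under $G$ if $\mu(w)\in\mathcal L(\mathbf u)$ for all $w\in\mathcal L(\mathbf u)$, $\mu\in G$. A number $n\ge 0$ is $G$-distinguishing on $\mathbf u$ if $\Theta_1(w)\ne\Theta_2(w)$ for all $w\in\mathcal L_n(\mathbf u)$ and all distinct antimorphisms $\Theta_1,\Theta_2\in G$. Write $[w]=\{\mu(w):\mu\in G\}$. The undirected graph of symmetries $\Gamma_n(\mathbf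 u)$ is the multigraph (loops and multiple edges allowed) whose vertices are the classes $[w]$ of special factors $w\in\mathcal L_n(\mathbf u)$ and whose edges are the classes $[e]$ of factors $e$ of length at least $n+1$ in which exactly two occurrences of factors of length $n$ are special, namely the prefix and the suffix of $e$ of length $n$; the edge $[e]$ joins the classes of this prefix and this suffix. The word $\mathbf u$ has Property $G$-tls$(N)$ if for every $n\ge N$: $\mathcal L(\mathbf u)$ is closed under $G$; whenever $[e]$ is a loop of $\Gamma_n(\mathbf u)$, $e$ is a $G$-palindrome; and the multigraph obtained from $\Gamma_n(\mathbf u)$ by removing all loops is a tree, i.e. connected and without cycles, where two parallel edges form a cycle and the empty graph counts as a tree. Let the language of $\mathbf u$ be closed under $G$ and let $N\ge0$ be $G$-distinguishing on $\mathbf u$. Then $\mathbf u$ has Property $G$-tls$(N)$ if and only if both of the following hold. 1. For every bispecial factor $w$ of $\mathbf u$ with $|w|\ge N$: if $w$ is not a $G$-palindrome, then $\mathrm b(w)=0$; and if $w$ is a $\Theta$-palindrome for an antimorphism $\Theta\in G$, then $\mathrm b(w)=\#\mathrm{Pext}_\Theta(w)-1$. 2. $\displaystyle \Delta\mathcal C(N)+\#G=\sum_{\Theta\in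 G^{(2)}}\bigl(\mathcal P_\Theta(N)+\mathcal P_\Theta(N+1)\bigr).$ -/

import Mathlib

namespace GRich

/-! Finite words over `A` are lists, infinite words are maps `ℕ → A`. -/

section Symmetries

variable {A : Type*}

/-- `φ(vw) = φ(v)φ(w)`. -/
def IsMorphism (φ : List A → List A) : Prop :=
  ∀ v w, φ (v ++ w) = φ v ++ φ w

/-- `φ(vw) = φ(w)φ(v)`. -/
def IsAntimorphism (φ : List A → List A) : Prop :=
  ∀ v w, φ (v ++ w) = φ w ++ φ v

/-- A finite group (under composition) of morphisms and antimorphisms of the free monoid on `A`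
which contains at least one antimorphism. -/
structure SymmetryGroup (A : Type*) where
  toSubgroup : Subgroup (Equiv.Perm (List A))
  finite_toSubgroup : Finite toSubgroup
  isMorphism_or_isAntimorphism : ∀ μ ∈ toSubgroup, IsMorphism μ ∨ IsAntimorphism μ
  exists_isAntimorphism : ∃ Θ ∈ toSubgroup, IsAntimorphism Θ

namespace SymmetryGroup

variable (G : SymmetryGroup A)

/-- The number of elements of the group. -/
noncomputable def card : ℕ := Nat.card G.toSubgroup

/-- The set of antimorphisms in the group. -/
def antimorphisms : Set (Equiv.Perm (List A)) :=
  {Θ | Θ ∈ G.toSubgroup ∧ IsAntimorphism Θ}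

/-- The set of involutive antimorphisms in the group. -/
def involutiveAntimorphisms : Set (Equiv.Perm (List A)) :=
  {Θ | Θ ∈ G.antimorphisms ∧ ∀ w, Θ (Θ w) = w}

/-- The class `[w]` of words that are `G`-equivalent to `w`. -/
def orbit (w : List A) : Set (List A) :=
  {v | ∃ μ ∈ G.toSubgroup, v = μ w}

/-- `w` is fixed by some antimorphism in the group. -/
def IsPalindrome (w : List A) : Prop :=
  ∃ Θ ∈ G.antimorphisms, Θ w = w

end SymmetryGroup

end Symmetries

section Words

variable {A : Type*} (u : ℕ → A)

/-- The set of factors of `u`. -/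
def language : Set (List A) :=
  {w | ∃ i : ℕ, w = (List.range w.length).map fun j => u (i + j)}

/-- The set of factors of `u` of length `n`. -/
def factors (n : ℕ) : Set (List A) :=
  {w | w ∈ language u ∧ w.length = n}

/-- The factor complexity. -/
noncomputable def complexity (n : ℕ) : ℕ := (factors u n).ncard

/-- The first difference of the factor complexity. -/
noncomputable def deltaComplexity (n : ℕ) : ℤ :=
  (complexity u (n + 1) : ℤ) - complexity u n

/-- The set of left extensions of `w`. -/
def Lext (w : List A) : Set A := {a | a :: w ∈ language u}

/-- The set of right extensions of `w`. -/
def Rext (w : List A) : Set A := {b | w ++ [b] ∈ language u}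

/-- The set of factors of the form `awb` with letters `a` and `b`. -/
def Bext (w : List A) : Set (List A) :=
  {v | v ∈ language u ∧ ∃ a b : A, v = a :: (w ++ [b])}

/-- The bilateral order of `w`. -/
noncomputable def bilateralOrder (w : List A) : ℤ :=
  ((Bext u w).ncard : ℤ) - (Lext u w).ncard - (Rext u w).ncard + 1

def IsLeftSpecial (w : List A) : Prop := w ∈ language u ∧ 2 ≤ (Lext u w).ncard

def IsRightSpecial (w : List A) : Prop := w ∈ language u ∧ 2 ≤ (Rext u w).ncard

def IsSpecial (w : List A) : Prop := IsLeftSpecial u w ∨ IsRightSpecial u w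

def IsBispecial (w : List A) : Prop := IsLeftSpecial u w ∧ IsRightSpecial u w

/-- The `Θ`-palindromic complexity. -/
noncomputable def palindromicComplexity (Θ : Equiv.Perm (List A)) (n : ℕ) : ℕ :=
  {w | w ∈ factors u n ∧ Θ w = w}.ncard

/-- The set of letters `a` such that `awΘ(a)` is a factor. -/
def Pext (Θ : Equiv.Perm (List A)) (w : List A) : Set A :=
  {a | a :: (w ++ Θ [a]) ∈ language u}

variable (G : SymmetryGroup A)

/-- The language of `u` is closed under `G`. -/
def ClosedUnder : Prop :=
  ∀ w ∈ language u, ∀ μ ∈ G.toSubgroup, μ w ∈ language u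

/-- The number `n` is `G`-distinguishing on `u`. -/
def IsDistinguishing (n : ℕ) : Prop :=
  ∀ w ∈ factors u n, ∀ Θ₁ ∈ G.antimorphisms, ∀ Θ₂ ∈ G.antimorphisms,
    Θ₁ ≠ Θ₂ → Θ₁ w ≠ Θ₂ w

end Words

section GraphOfSymmetries

variable {A : Type*}

/-- The edges of the directed graph of symmetries of order `n`: the factors of length at least
`n + 1` in which exactly two occurrences of factors of length `n` are special, namely the one as a
prefix and the one as a suffix. -/
def directedEdges (u : ℕ → A) (n : ℕ) : Set (List A) :=
  {e | e ∈ language u ∧ n + 1 ≤ e.length ∧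
    IsSpecial u (e.take n) ∧ IsSpecial u (e.drop (e.length - n)) ∧
    ∀ i, 0 < i → i < e.length - n → ¬ IsSpecial u ((e.drop i).take n)}

/-- The directed edge `e` starts in the class of its prefix of length `n`. -/
def source (G : SymmetryGroup A) (n : ℕ) (e : List A) : Set (List A) :=
  G.orbit (e.take n)

/-- The directed edge `e` ends in the class of its suffix of length `n`. -/
def target (G : SymmetryGroup A) (n : ℕ) (e : List A) : Set (List A) :=
  G.orbit (e.drop (e.length - n))

theorem orbit_apply (G : SymmetryGroup A) {μ : Equiv.Perm (List A)} (hμ : μ ∈ G.toSubgroup)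
    (w : List A) : G.orbit (μ w) = G.orbit w := by
  ext v
  constructor
  · rintro ⟨ν, hν, rfl⟩
    exact ⟨ν * μ, G.toSubgroup.mul_mem hν hμ, rfl⟩
  · rintro ⟨ν, hν, rfl⟩
    exact ⟨ν * μ⁻¹, G.toSubgroup.mul_mem hν (G.toSubgroup.inv_mem hμ), by simp⟩

theorem mem_orbit_self (G : SymmetryGroup A) (w : List A) : w ∈ G.orbit w :=
  ⟨1, G.toSubgroup.one_mem, rfl⟩

theorem length_le_apply (G : SymmetryGroup A) {μ : Equiv.Perm (List A)} (hμ : μ ∈ G.toSubgroup)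
    (w : List A) : w.length ≤ (μ w).length := by
  have h0 : μ [] = [] := by
    rcases G.isMorphism_or_isAntimorphism μ hμ with h | h <;>
    · have h1 := congrArg List.length (h [] [])
      simp only [List.append_nil, List.length_append] at h1
      exact List.length_eq_zero_iff.1 (by omega)
  induction w with
  | nil => simp
  | cons a w ih =>
    have ha : 1 ≤ (μ [a]).length := by
      rw [Nat.one_le_iff_ne_zero, Ne, List.length_eq_zero_iff]
      intro h
      have h2 := μ.injective (h.trans h0.symm)
      simp at h2
    rcases G.isMorphism_or_isAntimorphism μ hμ with h | h
    · have h1 := congrArg List.length (h [a] w)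
      simp only [List.singleton_append, List.length_append] at h1
      simp only [List.length_cons]
      omega
    · have h1 := congrArg List.length (h [a] w)
      simp only [List.singleton_append, List.length_append] at h1
      simp only [List.length_cons]
      omega

theorem length_apply (G : SymmetryGroup A) {μ : Equiv.Perm (List A)} (hμ : μ ∈ G.toSubgroup)
    (w : List A) : (μ w).length = w.length := by
  refine le_antisymm ?_ (length_le_apply G hμ w)
  have h := length_le_apply G (G.toSubgroup.inv_mem hμ) (μ w)
  simpa using h

theorem ends_apply (G : SymmetryGroup A) {μ : Equiv.Perm (List A)} (hμ : μ ∈ G.toSubgroup)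
    {n : ℕ} {e : List A} (he : n ≤ e.length) :
    (source G n (μ e) = source G n e ∧ target G n (μ e) = target G n e) ∨
      (source G n (μ e) = target G n e ∧ target G n (μ e) = source G n e) := by
  have hlen := length_apply G hμ
  have h1 := List.take_append_drop n e
  have h2 := List.take_append_drop (e.length - n) e
  unfold source target
  rw [hlen e]
  rcases G.isMorphism_or_isAntimorphism μ hμ with h | h
  · left
    have e1 : (μ e).take n = μ (e.take n) := by
      conv_lhs => rw [← h1, h]
      exact List.take_left' (by rw [hlen, List.length_take]; omega)
    have e2 : (μ e).drop (e.length - n) = μ (e.drop (e.length - n)) := by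
      conv_lhs => rw [← h2, h, h2]
      exact List.drop_left' (by rw [hlen, List.length_take]; omega)
    rw [e1, e2, orbit_apply G hμ, orbit_apply G hμ]
    exact ⟨rfl, rfl⟩
  · right
    have e1 : (μ e).take n = μ (e.drop (e.length - n)) := by
      conv_lhs => rw [← h2, h]
      exact List.take_left' (by rw [hlen, List.length_drop]; omega)
    have e2 : (μ e).drop (e.length - n) = μ (e.take n) := by
      conv_lhs => rw [← h1, h, h1]
      exact List.drop_left' (by rw [hlen, List.length_drop])
    rw [e1, e2, orbit_apply G hμ, orbit_apply G hμ]
    exact ⟨rfl, rfl⟩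

/-- The undirected graph of symmetries of `u` of order `n`, as a multigraph. Its vertices are the
classes of the special factors of length `n`, its edges are the classes of the directed edges, and
the class of a directed edge joins the start and the end of this directed edge. -/
def symmetriesGraph (G : SymmetryGroup A) (u : ℕ → A) (n : ℕ) :
    Graph (Set (List A)) (Set (List A)) where
  vertexSet := {x | ∃ w, w.length = n ∧ IsSpecial u w ∧ x = G.orbit w}
  edgeSet := {E | ∃ e ∈ directedEdges u n, E = G.orbit e}
  IsLink E x y := ∃ e ∈ directedEdges u n, E = G.orbit e ∧
    ((source G n e = x ∧ target G n e = y) ∨ (source G n e = y ∧ target G n e = x))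
  isLink_symm := by
    intro E _
    refine ⟨fun x y => ?_⟩
    rintro ⟨e, he, hE, h⟩
    exact ⟨e, he, hE, h.symm⟩
  eq_or_eq_of_isLink_of_isLink := by
    rintro E x y v w ⟨e, he, rfl, h⟩ ⟨f, hf, hE, h'⟩
    have hfe : f ∈ G.orbit e := hE ▸ mem_orbit_self G f
    obtain ⟨μ, hμ, rfl⟩ := hfe
    have hn : n ≤ e.length := by have := he.2.1; omega
    have := ends_apply G hμ hn
    grind
  edge_mem_iff_exists_isLink := by
    intro E
    constructor
    · rintro ⟨e, he, hE⟩
      exact ⟨_, _, e, he, hE, Or.inl ⟨rfl, rfl⟩⟩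
    · rintro ⟨x, y, e, he, hE, -⟩
      exact ⟨e, he, hE⟩
  left_mem_of_isLink := by
    rintro E x y ⟨e, he, -, h | h⟩
    · refine ⟨e.take n, ?_, he.2.2.1, h.1.symm⟩
      have := he.2.1
      rw [List.length_take]; omega
    · refine ⟨e.drop (e.length - n), ?_, he.2.2.2.1, h.2.symm⟩
      have := he.2.1
      rw [List.length_drop]; omega

/-- A multigraph is a tree if it is connected and has no cycles; a loop is a cycle, and so are two
edges with the same ends. The graph with no vertices is admitted. -/
def IsMultigraphTree {α β : Type*} (Γ : Graph α β) : Prop :=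
  Γ.Simple ∧ Γ.toSimpleGraph.Preconnected ∧ Γ.toSimpleGraph.IsAcyclic

/-- The set of edges of a multigraph that are loops. -/
def loops {α β : Type*} (Γ : Graph α β) : Set β := {e | ∃ x, Γ.IsLoopAt e x}

/-- Property `G`-tls(`N`). -/
def HasTreeLikeStructure (G : SymmetryGroup A) (u : ℕ → A) (N : ℕ) : Prop :=
  ∀ n, N ≤ n →
    ClosedUnder u G ∧
    (∀ e ∈ directedEdges u n, G.orbit e ∈ loops (symmetriesGraph G u n) → G.IsPalindrome e) ∧
    IsMultigraphTree ((symmetriesGraph G u n).deleteEdges (loops (symmetriesGraph G u n)))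

end GraphOfSymmetries

end GRich

/-!
The proof replaces both sides of the equivalence by one numerical condition for each order `n`,

  `ΔC(n) + #G = p(n) + p(n + 1)`    (`IsBalanced`),

where `p(n)` is the number of factors of length `n` that are palindromes for the group. From the
distinguishing order on, a nontrivial symmetry that fixes a factor is an involutive antimorphism,
and each palindrome is fixed by exactly one of them. So `p(n)` is the sum of the `Θ`-palindromic
complexities (`isBalanced_iff_finsum`), and a class contains `#G` words, or `#G / 2` if it consists
of palindromes. An invariant set of words therefore has `(#words + #palindromes) / #G` classes.

*The graph of symmetries.* Directed edges correspond to the factors of length `n + 1` with special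
prefix of length `n`, since a nonspecial factor has only one continuation; palindromic directed
edges correspond to their centers, which are the palindromes of length `n + 1` and the nonspecial
palindromes of length `n` (`bijOn_center`). Counting classes, order `n` is balanced if and only if
the graph has one vertex more than it has non-palindromic edges. Palindromic edges are loops, and
the graph is connected because `u` itself walks through it. Hence the balance says exactly that the
loops are the palindromic edges and that the other edges form a tree (`isTreeLike_iff_isBalanced`).
If there are no special factors of length `n`, the word is periodic, and the antimorphisms act as
reflections on the cycle of factors; each of them fixes two vertices or edges of the cycle.

*The bilateral orders.* Put `c(w)` for the number of palindromes `awb`, and `π(w) = 1` or `0`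
according to whether `w` is a palindrome. The sum of `b(w) - c(w) + π(w)` over all factors of
length `n` is the difference between the balances of the orders `n + 1` and `n`
(`sum_bilateralExcess`), and terms of factors that are not bispecial vanish. So the conditions on
the bilateral orders carry the balance from `N` to all larger orders. Conversely, if all orders are
balanced, these sums are zero, and it remains to see that no term is positive
(`bilateralExcess_nonpos`). Modulo the group, the extensions `aw`, `wb` are vertices and the
non-palindromic words `awb` are edges of the quotient of the Rauzy graph of order `n + 1`. This
quotient is connected, and in a balanced order it has the number of edges of a tree, so any set of
vertices spans fewer edges than it has elements; this is the required inequality.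
-/

namespace GRich

/-! ### Factors and their positions -/

/-- The factor of length `m` of `u` at position `i`. -/
def factorAt {A : Type*} (u : ℕ → A) (i m : ℕ) : List A :=
  (List.range m).map fun j => u (i + j)

section FactorAt

variable {A : Type*} (u : ℕ → A)

@[simp] theorem length_factorAt (i m : ℕ) : (factorAt u i m).length = m := by
  simp [factorAt]

theorem factorAt_mem (i m : ℕ) : factorAt u i m ∈ language u := ⟨i, by simp [factorAt]⟩

theorem factorAt_mem_factors (i m : ℕ) : factorAt u i m ∈ factors u m :=
  ⟨factorAt_mem u i m, length_factorAt u i m⟩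

variable {u} in
theorem exists_factorAt_of_mem {w : List A} (h : w ∈ language u) :
    ∃ i, factorAt u i w.length = w := by
  obtain ⟨i, hi⟩ := h
  exact ⟨i, hi.symm⟩

variable {u} in
theorem exists_factorAt_of_mem_factors {w : List A} {n : ℕ} (h : w ∈ factors u n) :
    ∃ i, factorAt u i n = w := by
  obtain ⟨i, hi⟩ := exists_factorAt_of_mem h.1
  exact ⟨i, h.2 ▸ hi⟩

theorem factorAt_add (i m k : ℕ) :
    factorAt u i (m + k) = factorAt u i m ++ factorAt u (i + m) k := by
  simp [factorAt, List.range_add, Function.comp_def, add_assoc]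

theorem factorAt_one (i : ℕ) : factorAt u i 1 = [u i] := by simp [factorAt]

theorem factorAt_succ (i m : ℕ) : factorAt u i (m + 1) = factorAt u i m ++ [u (i + m)] := by
  rw [factorAt_add, factorAt_one]

theorem factorAt_succ' (i m : ℕ) : factorAt u i (m + 1) = u i :: factorAt u (i + 1) m := by
  rw [add_comm m 1, factorAt_add, factorAt_one, List.singleton_append]

theorem take_factorAt (i : ℕ) {m k : ℕ} (h : k ≤ m) :
    (factorAt u i m).take k = factorAt u i k := by
  obtain ⟨l, rfl⟩ := Nat.exists_eq_add_of_le h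
  rw [factorAt_add, List.take_left' (length_factorAt u i k)]

theorem drop_factorAt (i : ℕ) {m k : ℕ} (h : k ≤ m) :
    (factorAt u i m).drop k = factorAt u (i + k) (m - k) := by
  obtain ⟨l, rfl⟩ := Nat.exists_eq_add_of_le h
  rw [factorAt_add, List.drop_left' (length_factorAt u i k), Nat.add_sub_cancel_left]

variable {u}

theorem left_mem_language {v w : List A} (h : v ++ w ∈ language u) : v ∈ language u := by
  obtain ⟨i, hi⟩ := exists_factorAt_of_mem h
  have := congrArg (List.take v.length) hi
  rw [take_factorAt u i (by simp), List.take_left' rfl] at this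
  exact this ▸ factorAt_mem u _ _

theorem right_mem_language {v w : List A} (h : v ++ w ∈ language u) : w ∈ language u := by
  obtain ⟨i, hi⟩ := exists_factorAt_of_mem h
  have := congrArg (List.drop v.length) hi
  rw [drop_factorAt u i (by simp), List.drop_left' rfl] at this
  exact this ▸ factorAt_mem u _ _

theorem take_mem_language {w : List A} (h : w ∈ language u) (k : ℕ) : w.take k ∈ language u :=
  left_mem_language (w := w.drop k) (by rwa [List.take_append_drop])

theorem drop_mem_language {w : List A} (h : w ∈ language u) (k : ℕ) : w.drop k ∈ language u :=
  right_mem_language (v := w.take k) (by rwa [List.take_append_drop])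

theorem finite_factors [Finite A] (n : ℕ) : (factors u n).Finite :=
  (List.finite_length_eq A n).subset fun _ hw => hw.2

end FactorAt

/-! ### Morphisms and antimorphisms in the group -/

section Group

variable {A : Type*}

theorem IsAntimorphism.inv {Θ : Equiv.Perm (List A)} (h : IsAntimorphism Θ) :
    IsAntimorphism (Θ⁻¹ : Equiv.Perm (List A)) := fun v w => by
  apply Θ.injective
  rw [h]
  simp

theorem IsMorphism.inv {μ : Equiv.Perm (List A)} (h : IsMorphism μ) :
    IsMorphism (μ⁻¹ : Equiv.Perm (List A)) := fun v w => by
  apply μ.injective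
  rw [h]
  simp

theorem IsMorphism.mul {μ ν : Equiv.Perm (List A)} (h : IsMorphism μ) (h' : IsMorphism ν) :
    IsMorphism (μ * ν : Equiv.Perm (List A)) := fun v w => by
  rw [Equiv.Perm.mul_apply, h', h]
  rfl

theorem IsAntimorphism.mul {μ ν : Equiv.Perm (List A)} (h : IsAntimorphism μ)
    (h' : IsAntimorphism ν) : IsMorphism (μ * ν : Equiv.Perm (List A)) := fun v w => by
  rw [Equiv.Perm.mul_apply, h', h]
  rfl

theorem IsAntimorphism.mul_isMorphism {μ ν : Equiv.Perm (List A)} (h : IsAntimorphism μ)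
    (h' : IsMorphism ν) : IsAntimorphism (μ * ν : Equiv.Perm (List A)) := fun v w => by
  rw [Equiv.Perm.mul_apply, h', h]
  rfl

variable (G : SymmetryGroup A)

/-- The set of morphisms in the group. -/
def SymmetryGroup.morphisms : Set (Equiv.Perm (List A)) :=
  {μ | μ ∈ G.toSubgroup ∧ IsMorphism μ}

variable {G}

theorem exists_apply_singleton {μ : Equiv.Perm (List A)} (hμ : μ ∈ G.toSubgroup) (a : A) :
    ∃ b, μ [a] = [b] :=
  List.length_eq_one_iff.1 (length_apply G hμ [a])

/-- As there are two letters, no symmetry is both a morphism and an antimorphism. -/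
theorem not_isMorphism_of_isAntimorphism [Nontrivial A] {μ : Equiv.Perm (List A)}
    (hμ : μ ∈ G.toSubgroup) (h : IsAntimorphism μ) : ¬ IsMorphism μ := by
  intro h'
  obtain ⟨a, b, hab⟩ := exists_pair_ne A
  obtain ⟨a', ha'⟩ := exists_apply_singleton hμ a
  obtain ⟨b', hb'⟩ := exists_apply_singleton hμ b
  have h1 := (h [a] [b]).symm.trans (h' [a] [b])
  rw [ha', hb'] at h1
  simp only [List.cons_append, List.nil_append, List.cons.injEq, and_true] at h1
  have := μ.injective (ha'.trans (h1.2 ▸ hb'.symm))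
  simp at this
  exact hab this

theorem card_eq [Nontrivial A] : G.card = 2 * G.morphisms.ncard ∧
    G.card = 2 * G.antimorphisms.ncard := by
  have := G.finite_toSubgroup
  have hfin : (G.toSubgroup : Set (Equiv.Perm (List A))).Finite := Set.toFinite _
  have hM : G.morphisms.Finite := hfin.subset fun μ h => h.1
  have hA : G.antimorphisms.Finite := hfin.subset fun μ h => h.1
  have hu : (G.toSubgroup : Set (Equiv.Perm (List A))) = G.morphisms ∪ G.antimorphisms := by
    ext μ
    constructor
    · intro h
      exact (G.isMorphism_or_isAntimorphism μ h).imp (⟨h, ·⟩) (⟨h, ·⟩)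
    · rintro (h | h) <;> exact h.1
  have hd : Disjoint G.morphisms G.antimorphisms :=
    Set.disjoint_left.2 fun μ h h' => not_isMorphism_of_isAntimorphism h'.1 h'.2 h.2
  have h1 : G.card = G.morphisms.ncard + G.antimorphisms.ncard := by
    rw [← Set.ncard_union_eq hd hM hA, ← hu]
    rfl
  obtain ⟨Θ, hΘ, hΘa⟩ := G.exists_isAntimorphism
  have h2 : G.morphisms.ncard = G.antimorphisms.ncard := by
    refine Set.BijOn.ncard_eq (f := fun μ => Θ * μ) ⟨?_, ?_, ?_⟩
    · exact fun μ h => ⟨G.toSubgroup.mul_mem hΘ h.1, hΘa.mul_isMorphism h.2⟩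
    · exact fun μ _ ν _ h => mul_left_cancel h
    · exact fun ν h => ⟨Θ⁻¹ * ν, ⟨G.toSubgroup.mul_mem (G.toSubgroup.inv_mem hΘ) h.1,
        hΘa.inv.mul h.2⟩, by simp⟩
  omega

theorem take_apply_of_isMorphism {μ : Equiv.Perm (List A)} (hμ : μ ∈ G.toSubgroup)
    (h : IsMorphism μ) (w : List A) (k : ℕ) : (μ w).take k = μ (w.take k) := by
  rcases le_total k w.length with hk | hk
  · conv_lhs => rw [← List.take_append_drop k w, h]
    exact List.take_left' (by rw [length_apply G hμ, List.length_take]; omega)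
  · rw [List.take_of_length_le hk, List.take_of_length_le (by rwa [length_apply G hμ])]

theorem drop_apply_of_isMorphism {μ : Equiv.Perm (List A)} (hμ : μ ∈ G.toSubgroup)
    (h : IsMorphism μ) (w : List A) {k : ℕ} (hk : k ≤ w.length) :
    (μ w).drop k = μ (w.drop k) := by
  conv_lhs => rw [← List.take_append_drop k w, h]
  exact List.drop_left' (by rw [length_apply G hμ, List.length_take]; omega)

theorem take_apply_of_isAntimorphism {μ : Equiv.Perm (List A)} (hμ : μ ∈ G.toSubgroup)
    (h : IsAntimorphism μ) (w : List A) {k : ℕ} (hk : k ≤ w.length) :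
    (μ w).take k = μ (w.drop (w.length - k)) := by
  conv_lhs => rw [← List.take_append_drop (w.length - k) w, h]
  exact List.take_left' (by rw [length_apply G hμ, List.length_drop]; omega)

theorem drop_apply_of_isAntimorphism {μ : Equiv.Perm (List A)} (hμ : μ ∈ G.toSubgroup)
    (h : IsAntimorphism μ) (w : List A) {k : ℕ} (hk : k ≤ w.length) :
    (μ w).drop k = μ (w.take (w.length - k)) := by
  conv_lhs => rw [← List.take_append_drop (w.length - k) w, h]
  exact List.drop_left' (by rw [length_apply G hμ, List.length_drop]; omega)

/-- The image of a word `a w b` extends the image of `w` by one letter on each side. -/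
theorem tail_dropLast_apply {μ : Equiv.Perm (List A)} (hμ : μ ∈ G.toSubgroup)
    (v : List A) {m : ℕ} (hv : v.length = m + 2) :
    ((μ v).drop 1).take m = μ ((v.drop 1).take m) := by
  rcases G.isMorphism_or_isAntimorphism μ hμ with h | h
  · rw [drop_apply_of_isMorphism hμ h v (by omega), take_apply_of_isMorphism hμ h]
  · rw [drop_apply_of_isAntimorphism hμ h v (by omega),
      take_apply_of_isAntimorphism hμ h _ (by rw [List.length_take]; omega),
      List.length_take, hv, List.drop_take]
    congr 2 <;> grind

end Group

section Recurrence

variable {A : Type*} {G : SymmetryGroup A} {u : ℕ → A}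

theorem exists_singleton_append_mem {w : List A} (h : w ∈ language u) :
    ∃ b, w ++ [b] ∈ language u := by
  obtain ⟨i, hi⟩ := exists_factorAt_of_mem h
  refine ⟨u (i + w.length), ?_⟩
  conv => enter [2, 1]; rw [← hi]
  rw [← factorAt_succ]
  exact factorAt_mem u _ _

/-- An antimorphism turns extensions to the right, which always exist, into extensions to the
left. -/
theorem exists_cons_mem (hG : ClosedUnder u G) {w : List A} (h : w ∈ language u) :
    ∃ a, a :: w ∈ language u := by
  obtain ⟨Θ, hΘ, hΘa⟩ := G.exists_isAntimorphism
  obtain ⟨b, hb⟩ := exists_singleton_append_mem (hG w h Θ hΘ)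
  have h1 := hG _ hb _ (G.toSubgroup.inv_mem hΘ)
  rw [hΘa.inv] at h1
  obtain ⟨a, ha⟩ := exists_apply_singleton (G.toSubgroup.inv_mem hΘ) b
  rw [ha] at h1
  exact ⟨a, by simpa using h1⟩

/-- If the language is closed under an antimorphism, then the word is recurrent. -/
theorem exists_ge_factorAt_eq (hG : ClosedUnder u G) (i m k : ℕ) :
    ∃ j, k ≤ j ∧ factorAt u j m = factorAt u i m := by
  induction k with
  | zero => exact ⟨i, Nat.zero_le _, rfl⟩
  | succ k ih =>
    obtain ⟨j, hj, hjm⟩ := ih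
    -- The prefix of length `j + m` has an extension to the left, so it also occurs later.
    obtain ⟨a, ha⟩ := exists_cons_mem hG (factorAt_mem u 0 (j + m))
    obtain ⟨l, hl⟩ := exists_factorAt_of_mem ha
    rw [List.length_cons, length_factorAt, factorAt_succ'] at hl
    have h1 := congrArg (List.drop j) (List.cons.inj hl).2
    rw [drop_factorAt u _ (by omega), drop_factorAt u _ (by omega), zero_add,
      Nat.add_sub_cancel_left] at h1
    exact ⟨l + 1 + j, by omega, h1.trans hjm⟩

theorem exists_ge_factorAt_of_mem (hG : ClosedUnder u G) {w : List A} (h : w ∈ language u)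
    (k : ℕ) : ∃ j, k ≤ j ∧ factorAt u j w.length = w := by
  obtain ⟨i, hi⟩ := exists_factorAt_of_mem h
  obtain ⟨j, hj, hji⟩ := exists_ge_factorAt_eq hG i w.length k
  exact ⟨j, hj, hji.trans hi⟩

end Recurrence

/-! ### Classes of words under the group -/

section Orbits

variable {A : Type*} {G : SymmetryGroup A} {u : ℕ → A} {N : ℕ}

theorem orbit_eq_iff {v w : List A} : G.orbit v = G.orbit w ↔ ∃ μ ∈ G.toSubgroup, v = μ w := by
  constructor
  · intro h
    have := h ▸ mem_orbit_self G v
    exact this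
  · rintro ⟨μ, hμ, rfl⟩
    exact orbit_apply G hμ w

theorem isPalindrome_apply {μ : Equiv.Perm (List A)} (hμ : μ ∈ G.toSubgroup) {w : List A}
    (h : G.IsPalindrome w) : G.IsPalindrome (μ w) := by
  obtain ⟨Θ, hΘ, hw⟩ := h
  refine ⟨μ * Θ * μ⁻¹, ⟨G.toSubgroup.mul_mem (G.toSubgroup.mul_mem hμ hΘ.1)
    (G.toSubgroup.inv_mem hμ), ?_⟩, by simp [hw]⟩
  intro v w
  rcases G.isMorphism_or_isAntimorphism μ hμ with h | h
  · rw [Equiv.Perm.mul_apply, Equiv.Perm.mul_apply, h.inv, hΘ.2, h]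
    rfl
  · rw [Equiv.Perm.mul_apply, Equiv.Perm.mul_apply, h.inv, hΘ.2, h]
    rfl

theorem isPalindrome_apply_iff {μ : Equiv.Perm (List A)} (hμ : μ ∈ G.toSubgroup) {w : List A} :
    G.IsPalindrome (μ w) ↔ G.IsPalindrome w := by
  refine ⟨fun h => ?_, isPalindrome_apply hμ⟩
  simpa using isPalindrome_apply (G.toSubgroup.inv_mem hμ) h

theorem isPalindrome_congr {v w : List A} (h : G.orbit v = G.orbit w) :
    G.IsPalindrome v ↔ G.IsPalindrome w := by
  obtain ⟨μ, hμ, rfl⟩ := orbit_eq_iff.1 h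
  exact isPalindrome_apply_iff hμ

theorem antimorphism_ext (hN : IsDistinguishing u G N) {w : List A} (hw : w ∈ language u)
    (hl : N ≤ w.length) {Θ₁ Θ₂ : Equiv.Perm (List A)} (h₁ : Θ₁ ∈ G.antimorphisms)
    (h₂ : Θ₂ ∈ G.antimorphisms) (h : Θ₁ w = Θ₂ w) : Θ₁ = Θ₂ := by
  by_contra hne
  -- The images of the prefix of length `N` are the suffixes of the images of `w`.
  refine hN (w.take N) ⟨take_mem_language hw N, by rw [List.length_take]; omega⟩
    Θ₁ h₁ Θ₂ h₂ hne ?_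
  have e := congrArg (List.drop (w.length - N)) h
  rwa [drop_apply_of_isAntimorphism h₁.1 h₁.2 w (by omega),
    drop_apply_of_isAntimorphism h₂.1 h₂.2 w (by omega),
    show w.length - (w.length - N) = N by omega] at e

theorem morphism_ext (hN : IsDistinguishing u G N) {w : List A} (hw : w ∈ language u)
    (hl : N ≤ w.length) {μ₁ μ₂ : Equiv.Perm (List A)} (h₁ : μ₁ ∈ G.morphisms)
    (h₂ : μ₂ ∈ G.morphisms) (h : μ₁ w = μ₂ w) : μ₁ = μ₂ := by
  obtain ⟨Θ, hΘ, hΘa⟩ := G.exists_isAntimorphism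
  exact mul_left_cancel (a := Θ) <| antimorphism_ext hN hw hl
    ⟨G.toSubgroup.mul_mem hΘ h₁.1, hΘa.mul_isMorphism h₁.2⟩
    ⟨G.toSubgroup.mul_mem hΘ h₂.1, hΘa.mul_isMorphism h₂.2⟩ (by simp [h])

theorem one_mem_morphisms : (1 : Equiv.Perm (List A)) ∈ G.morphisms :=
  ⟨G.toSubgroup.one_mem, fun _ _ => rfl⟩

/-- The antimorphisms that occur in the definition of palindromes in long factors are
involutions. -/
theorem mul_self_of_apply_eq (hN : IsDistinguishing u G N) {w : List A} (hw : w ∈ language u)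
    (hl : N ≤ w.length) {Θ : Equiv.Perm (List A)} (hΘ : Θ ∈ G.antimorphisms) (h : Θ w = w) :
    Θ * Θ = 1 :=
  morphism_ext hN hw hl ⟨G.toSubgroup.mul_mem hΘ.1 hΘ.1, hΘ.2.mul hΘ.2⟩ one_mem_morphisms
    (by simp [h])

/-- A symmetry that fixes a long factor is the identity or an antimorphism. -/
theorem eq_one_or_of_apply_eq (hN : IsDistinguishing u G N) {w : List A} (hw : w ∈ language u)
    (hl : N ≤ w.length) {μ : Equiv.Perm (List A)} (hμ : μ ∈ G.toSubgroup) (h : μ w = w) :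
    μ = 1 ∨ μ ∈ G.antimorphisms := by
  rcases G.isMorphism_or_isAntimorphism μ hμ with h' | h'
  · exact Or.inl (morphism_ext hN hw hl ⟨hμ, h'⟩ one_mem_morphisms h)
  · exact Or.inr ⟨hμ, h'⟩

theorem ncard_orbit_of_not_isPalindrome (hN : IsDistinguishing u G N) {w : List A}
    (hw : w ∈ language u) (hl : N ≤ w.length) (hp : ¬ G.IsPalindrome w) :
    (G.orbit w).ncard = G.card := by
  have : G.orbit w = (fun μ : Equiv.Perm (List A) => μ w) '' G.toSubgroup := by
    ext v
    simp only [SymmetryGroup.orbit, Set.mem_ofPred_eq, Set.mem_image, SetLike.mem_coe]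
    exact exists_congr fun μ => and_congr_right fun _ => eq_comm
  rw [this, Set.InjOn.ncard_image]
  · rfl
  · intro μ hμ ν hν h
    have hf : (ν⁻¹ * μ) w = w := by
      simp only at h
      simp [h]
    rcases eq_one_or_of_apply_eq hN hw hl
      (G.toSubgroup.mul_mem (G.toSubgroup.inv_mem hν) hμ) hf with h1 | h1
    · exact (inv_mul_eq_one.1 h1).symm
    · exact absurd ⟨_, h1, hf⟩ hp

theorem two_mul_ncard_orbit_of_isPalindrome [Nontrivial A] (hN : IsDistinguishing u G N)
    {w : List A} (hw : w ∈ language u) (hl : N ≤ w.length) (hp : G.IsPalindrome w) :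
    2 * (G.orbit w).ncard = G.card := by
  obtain ⟨Θ, hΘ, hΘw⟩ := hp
  have : G.orbit w = (fun μ : Equiv.Perm (List A) => μ w) '' G.morphisms := by
    ext v
    constructor
    · rintro ⟨μ, hμ, rfl⟩
      rcases G.isMorphism_or_isAntimorphism μ hμ with h | h
      · exact ⟨μ, ⟨hμ, h⟩, rfl⟩
      · exact ⟨μ * Θ, ⟨G.toSubgroup.mul_mem hμ hΘ.1, h.mul hΘ.2⟩, by simp [hΘw]⟩
    · rintro ⟨μ, hμ, rfl⟩
      exact ⟨μ, hμ.1, rfl⟩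
  rw [this, Set.InjOn.ncard_image, card_eq.1]
  exact fun μ hμ ν hν h => morphism_ext hN hw hl hμ hν h

/-- If an invariant finite set of words is divided into classes of `c` words each, then `c` times
the number of classes is the number of words. -/
theorem mul_ncard_image_orbit {c : ℕ} {X : Set (List A)} (hX : X.Finite)
    (hinv : ∀ x ∈ X, ∀ μ ∈ G.toSubgroup, μ x ∈ X) (hc : ∀ x ∈ X, (G.orbit x).ncard = c) :
    c * (G.orbit '' X).ncard = X.ncard := by
  classical
  lift X to Finset (List A) using hX
  rw [← Finset.coe_image, Set.ncard_coe_finset, Set.ncard_coe_finset,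
    Finset.card_eq_sum_card_image G.orbit X, mul_comm, ← smul_eq_mul, ← Finset.sum_const]
  refine Finset.sum_congr rfl fun O hO => ?_
  obtain ⟨x, hx, rfl⟩ := Finset.mem_image.1 hO
  rw [← hc x hx, ← Set.ncard_coe_finset]
  congr 1
  ext y
  simp only [Finset.coe_filter, Set.mem_ofPred_eq, orbit_eq_iff]
  constructor
  · rintro ⟨μ, hμ, rfl⟩
    exact ⟨hinv x hx μ hμ, μ, hμ, rfl⟩
  · rintro ⟨-, h⟩
    exact h

/-- The number of classes of words that are not palindromes. -/
theorem card_mul_ncard_orbits_not_isPalindrome (hN : IsDistinguishing u G N)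
    {X : Set (List A)} (hX : X.Finite) (hinv : ∀ x ∈ X, ∀ μ ∈ G.toSubgroup, μ x ∈ X)
    (hL : ∀ x ∈ X, x ∈ language u ∧ N ≤ x.length) :
    G.card * (G.orbit '' {x ∈ X | ¬ G.IsPalindrome x}).ncard
      = {x ∈ X | ¬ G.IsPalindrome x}.ncard :=
  mul_ncard_image_orbit (hX.subset fun _ h => h.1)
    (fun x hx μ hμ => ⟨hinv x hx.1 μ hμ, fun h => hx.2 ((isPalindrome_apply_iff hμ).1 h)⟩)
    fun x hx => ncard_orbit_of_not_isPalindrome hN (hL x hx.1).1 (hL x hx.1).2 hx.2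

theorem ncard_sep_not_add {X : Type*} {S : Set X} (hS : S.Finite) (P : X → Prop) :
    {x ∈ S | ¬ P x}.ncard + {x ∈ S | P x}.ncard = S.ncard := by
  rw [← Set.ncard_union_eq _ (hS.subset (Set.sep_subset _ _)) (hS.subset (Set.sep_subset _ _))]
  · congr 1
    ext x
    simp only [Set.mem_union, Set.mem_ofPred_eq]
    tauto
  · exact Set.disjoint_left.2 fun x h h' => h.2 h'.2

/-- Burnside's count of the classes: a long factor is fixed only by the identity and, if it is a
palindrome, by one antimorphism. -/
theorem card_mul_ncard_orbits [Nontrivial A] (hN : IsDistinguishing u G N)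
    {X : Set (List A)} (hX : X.Finite) (hinv : ∀ x ∈ X, ∀ μ ∈ G.toSubgroup, μ x ∈ X)
    (hL : ∀ x ∈ X, x ∈ language u ∧ N ≤ x.length) :
    G.card * (G.orbit '' X).ncard = X.ncard + {x ∈ X | G.IsPalindrome x}.ncard := by
  have h1 := card_mul_ncard_orbits_not_isPalindrome hN hX hinv hL
  have h2 : G.card * (G.orbit '' {x ∈ X | G.IsPalindrome x}).ncard
      = 2 * {x ∈ X | G.IsPalindrome x}.ncard := by
    have hm := card_eq (G := G) |>.1
    rw [hm, mul_assoc, mul_ncard_image_orbit (hX.subset (Set.sep_subset _ _))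
      (fun x (hx : x ∈ X ∧ G.IsPalindrome x) μ hμ =>
        ⟨hinv x hx.1 μ hμ, (isPalindrome_apply_iff hμ).2 hx.2⟩)]
    intro x hx
    have := two_mul_ncard_orbit_of_isPalindrome hN (hL x hx.1).1 (hL x hx.1).2 hx.2
    omega
  have h3 : (G.orbit '' X).ncard = (G.orbit '' {x ∈ X | ¬ G.IsPalindrome x}).ncard +
      (G.orbit '' {x ∈ X | G.IsPalindrome x}).ncard := by
    rw [← Set.ncard_union_eq _ ((hX.subset (Set.sep_subset _ _)).image _)
      ((hX.subset (Set.sep_subset _ _)).image _), ← Set.image_union]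
    · congr 2
      ext x
      simp only [Set.mem_union, Set.mem_ofPred_eq]
      tauto
    · rw [Set.disjoint_left]
      rintro _ ⟨x, hx, rfl⟩ ⟨y, hy, hxy⟩
      exact hx.2 ((isPalindrome_congr hxy).1 hy.2)
  have h4 := ncard_sep_not_add hX G.IsPalindrome
  rw [h3, mul_add, h1, h2]
  omega

end Orbits

/-! ### Counting vertices and edges of quotients of the Rauzy graphs -/

/-- A connected graph has at most one vertex more than it has edges. The graph is given by a walk
`F` that visits all its vertices; `l i` is the edge of the `i`-th step, and `E` contains the edges
that are not loops. -/
theorem ncard_range_le_ncard_add_one {V B : Type*} (F : ℕ → V) (l : ℕ → B) {E : Set B}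
    (hE : E.Finite) (hl : ∀ i j, l i = l j → s(F i, F (i + 1)) = s(F j, F (j + 1)))
    (hF : ∀ i, F i ≠ F (i + 1) → l i ∈ E) :
    (Set.range F).ncard ≤ E.ncard + 1 := by
  classical
  have key : ∀ n, ((Finset.range (n + 1)).image F).card ≤
      (((Finset.range n).filter fun i => F i ≠ F (i + 1)).image l).card + 1 := by
    intro n
    induction n with
    | zero => simp
    | succ n ih =>
      rw [Finset.range_add_one, Finset.image_insert]
      by_cases hn : F (n + 1) ∈ (Finset.range (n + 1)).image F
      · rw [Finset.insert_eq_of_mem hn]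
        refine ih.trans (Nat.add_le_add_right (Finset.card_le_card (Finset.image_subset_image
          (Finset.filter_subset_filter _ (Finset.range_mono (Nat.le_succ n))))) 1)
      · have hne : F n ≠ F (n + 1) := fun h =>
          hn (h ▸ Finset.mem_image_of_mem F (Finset.self_mem_range_succ n))
        -- A new vertex is reached through a new edge.
        have hnew : l n ∉ ((Finset.range n).filter fun i => F i ≠ F (i + 1)).image l := by
          intro h
          obtain ⟨i, hi, hil⟩ := Finset.mem_image.1 h
          have hi := Finset.mem_range.1 (Finset.mem_filter.1 hi).1
          have hmem : F (n + 1) ∈ s(F i, F (i + 1)) := by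
            rw [hl i n hil]
            exact Sym2.mem_mk_right _ _
          apply hn
          rcases Sym2.mem_iff.1 hmem with h | h <;> rw [h] <;>
            exact Finset.mem_image_of_mem F (Finset.mem_range.2 (by omega))
        have hstep : (Finset.range (n + 1)).filter (fun i => F i ≠ F (i + 1)) =
            insert n ((Finset.range n).filter fun i => F i ≠ F (i + 1)) := by
          rw [Finset.range_add_one, Finset.filter_insert, if_pos hne]
        rw [Finset.card_insert_of_notMem hn, hstep, Finset.image_insert,
          Finset.card_insert_of_notMem hnew]
        exact Nat.add_le_add_right ih 1
  have bound : ∀ n, ((Finset.range (n + 1)).image F).card ≤ E.ncard + 1 := by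
    refine fun n => (key n).trans (Nat.add_le_add_right ?_ 1)
    rw [← Set.ncard_coe_finset]
    refine Set.ncard_le_ncard ?_ hE
    intro e he
    simp only [Finset.coe_image, Finset.coe_filter, Set.mem_image, Set.mem_ofPred_eq] at he
    obtain ⟨i, hi, rfl⟩ := he
    exact hF i hi.2
  by_cases hfin : (Set.range F).Finite
  · obtain ⟨s, hs⟩ := Finset.subset_set_image_iff (s := Set.univ) (t := hfin.toFinset) (f := F) |>.1
      (by simp)
    refine le_trans ?_ (bound (s.sup id))
    rw [Set.ncard_eq_toFinset_card _ hfin, ← hs.2]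
    refine Finset.card_le_card (Finset.image_subset_image fun i hi => ?_)
    exact Finset.mem_range.2 (Nat.lt_succ_of_le (Finset.le_sup (f := id) hi))
  · rw [Set.Infinite.ncard hfin]
    exact Nat.zero_le _

section RauzyQuotient

variable {A : Type*} {G : SymmetryGroup A} {u : ℕ → A} {N : ℕ}

/-- The set of factors of length `n` that are palindromes for the group. -/
def palindromes (u : ℕ → A) (G : SymmetryGroup A) (n : ℕ) : Set (List A) :=
  {w ∈ factors u n | G.IsPalindrome w}

/-- The equality `ΔC(n) + #G = p(n) + p(n + 1)`, where `p` counts the palindromic factors for the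
group. -/
def IsBalanced (u : ℕ → A) (G : SymmetryGroup A) (n : ℕ) : Prop :=
  deltaComplexity u n + G.card = (palindromes u G n).ncard + (palindromes u G (n + 1)).ncard

/-- The vertices of the quotient of the Rauzy graph of order `m`. -/
def rauzyVertices (u : ℕ → A) (G : SymmetryGroup A) (m : ℕ) : Set (Set (List A)) :=
  G.orbit '' factors u m

/-- The edges of the quotient of the Rauzy graph of order `m`, without the classes of palindromes
(which are loops). -/
def rauzyEdges (u : ℕ → A) (G : SymmetryGroup A) (m : ℕ) : Set (Set (List A)) :=
  G.orbit '' {e ∈ factors u (m + 1) | ¬ G.IsPalindrome e}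

theorem apply_mem_factors (hG : ClosedUnder u G) {n : ℕ} {w : List A} (hw : w ∈ factors u n)
    {μ : Equiv.Perm (List A)} (hμ : μ ∈ G.toSubgroup) : μ w ∈ factors u n :=
  ⟨hG w hw.1 μ hμ, (length_apply G hμ w).trans hw.2⟩

theorem card_mul_ncard_rauzyVertices [Finite A] [Nontrivial A] (hG : ClosedUnder u G)
    (hN : IsDistinguishing u G N) {m : ℕ} (hm : N ≤ m) :
    G.card * (rauzyVertices u G m).ncard = complexity u m + (palindromes u G m).ncard :=
  card_mul_ncard_orbits hN (finite_factors m) (fun _ hx _ hμ => apply_mem_factors hG hx hμ)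
    fun _ hx => ⟨hx.1, hx.2 ▸ hm⟩

theorem card_mul_ncard_rauzyEdges [Finite A] (hG : ClosedUnder u G)
    (hN : IsDistinguishing u G N) {m : ℕ} (hm : N ≤ m) :
    G.card * (rauzyEdges u G m).ncard + (palindromes u G (m + 1)).ncard
      = complexity u (m + 1) := by
  have h1 := card_mul_ncard_orbits_not_isPalindrome hN (finite_factors (u := u) (m + 1))
    (fun _ hx _ hμ => apply_mem_factors hG hx hμ) fun _ hx => ⟨hx.1, by rw [hx.2]; omega⟩
  have h2 := ncard_sep_not_add (finite_factors (u := u) (m + 1)) G.IsPalindrome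
  unfold rauzyEdges palindromes complexity
  rw [h1, h2]

theorem card_pos (G : SymmetryGroup A) : 0 < G.card := by
  have := G.finite_toSubgroup
  exact Nat.card_pos

theorem isBalanced_iff [Finite A] [Nontrivial A] (hG : ClosedUnder u G)
    (hN : IsDistinguishing u G N) {m : ℕ} (hm : N ≤ m) :
    IsBalanced u G m ↔ (rauzyVertices u G m).ncard = (rauzyEdges u G m).ncard + 1 := by
  have h1 := card_mul_ncard_rauzyVertices hG hN hm
  have h2 := card_mul_ncard_rauzyEdges hG hN hm
  rw [← Nat.mul_right_inj (card_pos G).ne', mul_add, mul_one, h1, IsBalanced, deltaComplexity]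
  omega

theorem source_eq_target_of_isPalindrome {e : List A} (he : G.IsPalindrome e) {n : ℕ}
    (hn : n ≤ e.length) : source G n e = target G n e := by
  obtain ⟨Θ, hΘ, h⟩ := he
  unfold source target
  rw [← orbit_apply G hΘ.1 (e.drop _), ← take_apply_of_isAntimorphism hΘ.1 hΘ.2 e hn, h]

theorem source_factorAt (i m k : ℕ) :
    source G m (factorAt u i (m + k)) = G.orbit (factorAt u i m) := by
  rw [source, take_factorAt u i (by omega)]

theorem target_factorAt (i m k : ℕ) :
    target G m (factorAt u i (m + k)) = G.orbit (factorAt u (i + k) m) := by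
  rw [target, length_factorAt, drop_factorAt u i (by omega), Nat.add_sub_cancel_left,
    Nat.add_sub_cancel]

/-- The quotient of the Rauzy graph remains connected when a set `W` of vertices is contracted to
one vertex, so it has at least as many remaining edges as remaining vertices outside `W`. The
set `K` consists of edges that become loops. -/
theorem ncard_rauzyVertices_diff_le [Finite A] (m : ℕ) {W K : Set (Set (List A))}
    (hW : W ⊆ rauzyVertices u G m) (hne : W.Nonempty)
    (hK : ∀ i, G.orbit (factorAt u i (m + 1)) ∈ K →
      G.orbit (factorAt u i m) ∈ W ∧ G.orbit (factorAt u (i + 1) m) ∈ W) :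
    (rauzyVertices u G m \ W).ncard ≤ (rauzyEdges u G m \ K).ncard := by
  classical
  let c : Set (List A) → Option (Set (List A)) := fun x => if x ∈ W then none else some x
  let F : ℕ → Option (Set (List A)) := fun i => c (G.orbit (factorAt u i m))
  have hEfin : (rauzyEdges u G m).Finite :=
    ((finite_factors (m + 1)).subset (Set.sep_subset _ _)).image _
  have hVfin : (rauzyVertices u G m).Finite := (finite_factors m).image _
  have h1 := ncard_range_le_ncard_add_one F (fun i => G.orbit (factorAt u i (m + 1)))
    (E := rauzyEdges u G m \ K) (hEfin.subset Set.sdiff_subset) ?_ ?_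
  · have h2 : Set.range F = insert none (some '' (rauzyVertices u G m \ W)) := by
      ext x
      simp only [Set.mem_range, Set.mem_insert_iff, Set.mem_image, F, c]
      constructor
      · rintro ⟨i, rfl⟩
        by_cases h : G.orbit (factorAt u i m) ∈ W
        · exact Or.inl (if_pos h)
        · exact Or.inr ⟨_, ⟨⟨_, factorAt_mem_factors u i m, rfl⟩, h⟩, (if_neg h).symm⟩
      · rintro (rfl | ⟨x, ⟨⟨w, hw, rfl⟩, hx⟩, rfl⟩)
        · obtain ⟨x, hx⟩ := hne
          obtain ⟨w, hw, rfl⟩ := hW hx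
          obtain ⟨i, rfl⟩ := exists_factorAt_of_mem_factors hw
          exact ⟨i, if_pos hx⟩
        · obtain ⟨i, rfl⟩ := exists_factorAt_of_mem_factors hw
          exact ⟨i, if_neg hx⟩
    rw [h2, Set.ncard_insert_of_notMem (by simp) ((hVfin.subset Set.sdiff_subset).image _),
      Set.ncard_image_of_injective _ (Option.some_injective _)] at h1
    omega
  · intro i j hij
    obtain ⟨μ, hμ, h⟩ := orbit_eq_iff.1 hij
    have := ends_apply G hμ (n := m) (e := factorAt u j (m + 1)) (by simp)
    rw [← h, source_factorAt, target_factorAt, source_factorAt, target_factorAt] at this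
    rcases this with ⟨h1, h2⟩ | ⟨h1, h2⟩
    · simp only [F, h1, h2]
    · simp only [F, h1, h2, Sym2.eq_swap]
  · intro i hi
    refine ⟨⟨_, ⟨factorAt_mem_factors u i (m + 1), fun hp => hi ?_⟩, rfl⟩, fun h => hi ?_⟩
    · have := source_eq_target_of_isPalindrome hp (n := m) (by simp)
      rw [source_factorAt, target_factorAt] at this
      simp only [F, this]
    · simp only [F, c, if_pos (hK i h).1, if_pos (hK i h).2]

/-- In a balanced order the quotient of the Rauzy graph without the palindromic loops is a tree, so
that every nonempty set of vertices spans fewer edges than it has vertices. -/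
theorem IsBalanced.ncard_add_one_le [Finite A] [Nontrivial A] (hG : ClosedUnder u G)
    (hN : IsDistinguishing u G N) {m : ℕ} (hm : N ≤ m) (hb : IsBalanced u G m)
    {W K : Set (Set (List A))}
    (hW : W ⊆ rauzyVertices u G m) (hne : W.Nonempty) (hKE : K ⊆ rauzyEdges u G m)
    (hK : ∀ i, G.orbit (factorAt u i (m + 1)) ∈ K →
      G.orbit (factorAt u i m) ∈ W ∧ G.orbit (factorAt u (i + 1) m) ∈ W) :
    K.ncard + 1 ≤ W.ncard := by
  have hEfin : (rauzyEdges u G m).Finite :=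
    ((finite_factors (m + 1)).subset (Set.sep_subset _ _)).image _
  have hVfin : (rauzyVertices u G m).Finite := (finite_factors m).image _
  have h1 := ncard_rauzyVertices_diff_le m hW hne hK
  have h2 := Set.ncard_sdiff_add_ncard_of_subset hW hVfin
  have h3 := Set.ncard_sdiff_add_ncard_of_subset hKE hEfin
  have h4 := (isBalanced_iff hG hN hm).1 hb
  omega

/-- One half of the balance holds in every order, because the quotient of the Rauzy graph is
connected. -/
theorem ncard_palindromes_add_le [Finite A] [Nontrivial A] (hG : ClosedUnder u G)
    (hN : IsDistinguishing u G N) {m : ℕ} (hm : N ≤ m) :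
    ((palindromes u G m).ncard + (palindromes u G (m + 1)).ncard : ℤ) ≤
      deltaComplexity u m + G.card := by
  have hVfin : (rauzyVertices u G m).Finite := (finite_factors m).image _
  have h0 : G.orbit (factorAt u 0 m) ∈ rauzyVertices u G m :=
    ⟨_, factorAt_mem_factors u 0 m, rfl⟩
  have h1 := ncard_rauzyVertices_diff_le (u := u) (G := G) m
    (Set.singleton_subset_iff.2 h0) (K := ∅) (Set.singleton_nonempty _) (by simp)
  have h2 := Set.ncard_sdiff_add_ncard_of_subset (Set.singleton_subset_iff.2 h0) hVfin
  rw [Set.ncard_singleton] at h2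
  rw [Set.sdiff_empty] at h1
  have h3 := card_mul_ncard_rauzyVertices hG hN hm
  have h4 := card_mul_ncard_rauzyEdges hG hN hm
  have h5 : G.card * (rauzyVertices u G m).ncard ≤
      G.card * ((rauzyEdges u G m).ncard + 1) := Nat.mul_le_mul_left _ (by omega)
  rw [mul_add, mul_one] at h5
  rw [deltaComplexity]
  omega

end RauzyQuotient

/-! ### Extensions of factors -/

section Extensions

variable {A : Type*} {G : SymmetryGroup A} {u : ℕ → A} {N : ℕ}

/-- The factors that extend `w` by one letter to the left. -/
def leftExtensions (u : ℕ → A) (w : List A) : Set (List A) :=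
  {v ∈ factors u (w.length + 1) | v.drop 1 = w}

/-- The factors that extend `w` by one letter to the right. -/
def rightExtensions (u : ℕ → A) (w : List A) : Set (List A) :=
  {v ∈ factors u (w.length + 1) | v.take w.length = w}

theorem leftExtensions_eq (w : List A) : leftExtensions u w = (· :: w) '' Lext u w := by
  ext v
  constructor
  · rintro ⟨⟨hv, hl⟩, hd⟩
    obtain ⟨a, v, rfl⟩ := List.exists_cons_of_length_eq_add_one hl
    simp only [List.drop_succ_cons, List.drop_zero] at hd
    subst hd
    exact ⟨a, hv, rfl⟩
  · rintro ⟨a, ha, rfl⟩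
    exact ⟨⟨ha, rfl⟩, rfl⟩

theorem rightExtensions_eq (w : List A) :
    rightExtensions u w = (fun b => w ++ [b]) '' Rext u w := by
  ext v
  constructor
  · rintro ⟨⟨hv, hl⟩, hd⟩
    obtain ⟨b, hb⟩ : ∃ b, v.drop w.length = [b] :=
      List.length_eq_one_iff.1 (by rw [List.length_drop]; omega)
    have : w ++ [b] = v := by rw [← hb]; conv_lhs => enter [1]; rw [← hd]
                              exact List.take_append_drop _ _
    subst this
    exact ⟨b, hv, rfl⟩
  · rintro ⟨b, hb, rfl⟩
    exact ⟨⟨hb, by simp⟩, by simp⟩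

theorem Bext_eq (w : List A) :
    Bext u w = {v ∈ factors u (w.length + 2) | (v.drop 1).take w.length = w} := by
  ext v
  constructor
  · rintro ⟨hv, a, b, rfl⟩
    exact ⟨⟨hv, by simp⟩, by simp⟩
  · rintro ⟨⟨hv, hl⟩, hd⟩
    refine ⟨hv, ?_⟩
    obtain ⟨a, v, rfl⟩ := List.exists_cons_of_length_eq_add_one hl
    simp only [List.drop_succ_cons, List.drop_zero, List.length_cons] at hd hl
    obtain ⟨b, hb⟩ : ∃ b, v.drop w.length = [b] :=
      List.length_eq_one_iff.1 (by rw [List.length_drop]; omega)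
    refine ⟨a, b, ?_⟩
    rw [← hb]
    conv_rhs => enter [2, 1]; rw [← hd]
    rw [List.take_append_drop]

theorem finite_leftExtensions [Finite A] (w : List A) : (leftExtensions u w).Finite :=
  (finite_factors _).subset (Set.sep_subset _ _)

theorem finite_rightExtensions [Finite A] (w : List A) : (rightExtensions u w).Finite :=
  (finite_factors _).subset (Set.sep_subset _ _)

theorem finite_Bext [Finite A] (w : List A) : (Bext u w).Finite := by
  rw [Bext_eq]
  exact (finite_factors _).subset (Set.sep_subset _ _)

theorem ncard_leftExtensions (w : List A) : (leftExtensions u w).ncard = (Lext u w).ncard := by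
  rw [leftExtensions_eq, Set.ncard_image_of_injective]
  exact fun a b h => (List.cons.inj h).1

theorem ncard_rightExtensions (w : List A) : (rightExtensions u w).ncard = (Rext u w).ncard := by
  rw [rightExtensions_eq, Set.ncard_image_of_injective]
  exact fun a b h => by simpa using h

theorem Lext_nonempty (hG : ClosedUnder u G) {w : List A} (hw : w ∈ language u) :
    (Lext u w).Nonempty :=
  exists_cons_mem hG hw

theorem Rext_nonempty {w : List A} (hw : w ∈ language u) : (Rext u w).Nonempty :=
  exists_singleton_append_mem hw

theorem apply_mem_Bext (hG : ClosedUnder u G) {w : List A} {μ : Equiv.Perm (List A)}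
    (hμ : μ ∈ G.toSubgroup) {v : List A} (hv : v ∈ Bext u w) : μ v ∈ Bext u (μ w) := by
  rw [Bext_eq] at hv ⊢
  refine ⟨?_, ?_⟩
  · rw [length_apply G hμ]
    exact apply_mem_factors hG hv.1 hμ
  · rw [length_apply G hμ, tail_dropLast_apply hμ v hv.1.2, hv.2]

/-- A symmetry between two bilateral extensions of `w` fixes `w`. -/
theorem apply_eq_of_mem_Bext {w : List A} {μ : Equiv.Perm (List A)}
    (hμ : μ ∈ G.toSubgroup) {v : List A} (hv : v ∈ Bext u w) (hv' : μ v ∈ Bext u w) :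
    μ w = w := by
  rw [Bext_eq] at hv hv'
  have := tail_dropLast_apply hμ v hv.1.2
  rw [hv.2, hv'.2] at this
  exact this.symm

theorem isPalindrome_of_mem_Bext {w v : List A} (hv : v ∈ Bext u w) (hp : G.IsPalindrome v) :
    G.IsPalindrome w := by
  obtain ⟨Θ, hΘ, h⟩ := hp
  exact ⟨Θ, hΘ, apply_eq_of_mem_Bext hΘ.1 hv (h.symm ▸ hv)⟩

/-- An antimorphism that fixes `w` exchanges its left and its right extensions. -/
theorem bijOn_leftExtensions (hG : ClosedUnder u G) {w : List A} {Θ : Equiv.Perm (List A)}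
    (hΘ : Θ ∈ G.antimorphisms) (h : Θ w = w) :
    Set.BijOn Θ (leftExtensions u w) (rightExtensions u w) := by
  refine ⟨fun v hv => ⟨apply_mem_factors hG hv.1 hΘ.1, ?_⟩, Θ.injective.injOn, fun v hv => ?_⟩
  · have hl := hv.1.2
    rw [take_apply_of_isAntimorphism hΘ.1 hΘ.2 v (by omega), hl, Nat.add_sub_cancel_left, hv.2, h]
  · have hΘ' := G.toSubgroup.inv_mem hΘ.1
    refine ⟨Θ⁻¹ v, ⟨apply_mem_factors hG hv.1 hΘ', ?_⟩, by simp⟩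
    have hl := hv.1.2
    rw [drop_apply_of_isAntimorphism hΘ' hΘ.2.inv v (by omega), hl, Nat.add_sub_cancel, hv.2]
    exact Equiv.Perm.inv_eq_iff_eq.2 h.symm

theorem ncard_Lext_eq_ncard_Rext (hG : ClosedUnder u G) {w : List A} (hp : G.IsPalindrome w) :
    (Lext u w).ncard = (Rext u w).ncard := by
  obtain ⟨Θ, hΘ, h⟩ := hp
  rw [← ncard_leftExtensions, ← ncard_rightExtensions, (bijOn_leftExtensions hG hΘ h).ncard_eq]

theorem orbit_image_extensions_of_isPalindrome (hG : ClosedUnder u G) {w : List A}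
    (hp : G.IsPalindrome w) :
    G.orbit '' (leftExtensions u w ∪ rightExtensions u w) = G.orbit '' leftExtensions u w := by
  obtain ⟨Θ, hΘ, h⟩ := hp
  rw [Set.image_union, Set.union_eq_left, ← (bijOn_leftExtensions hG hΘ h).image_eq,
    Set.image_image]
  rintro _ ⟨v, hv, rfl⟩
  exact ⟨v, hv, (orbit_apply G hΘ.1 v).symm⟩

/-- The palindromic bilateral extensions of `w`. -/
def palindromicExtensions (u : ℕ → A) (G : SymmetryGroup A) (w : List A) : Set (List A) :=
  {v ∈ Bext u w | G.IsPalindrome v}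

theorem palindromicExtensions_eq_empty {w : List A} (hp : ¬ G.IsPalindrome w) :
    palindromicExtensions u G w = ∅ :=
  Set.eq_empty_of_forall_notMem fun _ hv => hp (isPalindrome_of_mem_Bext hv.1 hv.2)

theorem ncard_palindromicExtensions (hN : IsDistinguishing u G N) {w : List A}
    (hw : w ∈ language u) (hl : N ≤ w.length) {Θ : Equiv.Perm (List A)}
    (hΘ : Θ ∈ G.antimorphisms) (h : Θ w = w) :
    (palindromicExtensions u G w).ncard = (Pext u Θ w).ncard := by
  have : palindromicExtensions u G w = (fun a => a :: (w ++ Θ [a])) '' Pext u Θ w := by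
    ext v
    constructor
    · rintro ⟨hv, Θ', hΘ', hp⟩
      have hw' := apply_eq_of_mem_Bext hΘ'.1 hv (hp.symm ▸ hv)
      obtain rfl := antimorphism_ext hN hw hl hΘ' hΘ (hw'.trans h.symm)
      obtain ⟨hvL, a, b, rfl⟩ := hv
      have h1 := hp
      rw [← List.singleton_append, hΘ'.2, hΘ'.2, h] at h1
      obtain ⟨a', ha⟩ := exists_apply_singleton hΘ'.1 a
      obtain ⟨b', hb⟩ := exists_apply_singleton hΘ'.1 b
      have h2 : Θ' [a] = [b] := by
        rw [ha, hb] at h1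
        simp only [List.cons_append, List.nil_append, List.cons.injEq] at h1
        rw [ha]
        simpa using h1.2
      refine ⟨a, ?_, ?_⟩
      · rw [Pext, Set.mem_ofPred_eq, h2]
        exact hvL
      · simp only [h2]
    · rintro ⟨a, ha, rfl⟩
      obtain ⟨b, hb⟩ := exists_apply_singleton hΘ.1 a
      refine ⟨⟨ha, a, b, by simp only [hb]⟩, Θ, hΘ, ?_⟩
      have hinv : Θ (Θ [a]) = [a] :=
        Equiv.Perm.ext_iff.1 (mul_self_of_apply_eq hN hw hl hΘ h) [a]
      change Θ ([a] ++ (w ++ Θ [a])) = [a] ++ (w ++ Θ [a])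
      rw [hΘ.2, hΘ.2, h, hinv, List.append_assoc]
  rw [this, Set.ncard_image_of_injective]
  exact fun a b h => (List.cons.inj h).1

/-- The difference between the bilateral order of `w` and the value required of it: the number of
palindromic bilateral extensions minus one if `w` is a palindrome, and zero otherwise. In the second
case there are no palindromic bilateral extensions. -/
noncomputable def bilateralExcess (u : ℕ → A) (G : SymmetryGroup A) (w : List A) : ℤ :=
  open Classical in
  bilateralOrder u w - (palindromicExtensions u G w).ncard + if G.IsPalindrome w then 1 else 0

theorem bilateralExcess_eq_zero_iff (hN : IsDistinguishing u G N) {w : List A}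
    (hw : w ∈ language u) (hl : N ≤ w.length) :
    bilateralExcess u G w = 0 ↔
      (¬ G.IsPalindrome w → bilateralOrder u w = 0) ∧
      (∀ Θ ∈ G.antimorphisms, Θ w = w →
        bilateralOrder u w = ((Pext u Θ w).ncard : ℤ) - 1) := by
  unfold bilateralExcess
  by_cases hp : G.IsPalindrome w
  · rw [if_pos hp]
    constructor
    · intro h
      refine ⟨fun h' => absurd hp h', fun Θ hΘ hΘw => ?_⟩
      rw [ncard_palindromicExtensions hN hw hl hΘ hΘw] at h
      omega
    · intro h
      obtain ⟨Θ, hΘ, hΘw⟩ := hp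
      rw [h.2 Θ hΘ hΘw, ncard_palindromicExtensions hN hw hl hΘ hΘw]
      omega
  · rw [if_neg hp, palindromicExtensions_eq_empty hp]
    simp only [Set.ncard_empty, Nat.cast_zero, sub_zero, add_zero]
    exact ⟨fun h => ⟨fun _ => h, fun Θ hΘ hΘw => absurd ⟨Θ, hΘ, hΘw⟩ hp⟩, fun h => h.1 hp⟩

theorem ncard_eq_one_of_lt_two [Finite A] {S : Set A} (h : S.Nonempty) (h2 : ¬ 2 ≤ S.ncard) :
    S.ncard = 1 := by
  have := (Set.ncard_pos (Set.toFinite S)).2 h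
  omega

theorem ncard_Bext_of_ncard_Lext_eq_one (hG : ClosedUnder u G) {w : List A}
    (h : (Lext u w).ncard = 1) : (Bext u w).ncard = (Rext u w).ncard := by
  obtain ⟨a, ha⟩ := Set.ncard_eq_one.1 h
  have : Bext u w = (fun b => a :: (w ++ [b])) '' Rext u w := by
    ext v
    constructor
    · rintro ⟨hv, a', b, rfl⟩
      have h1 : a' ∈ Lext u w := left_mem_language (w := [b]) (by simpa using hv)
      rw [ha] at h1
      obtain rfl := h1
      exact ⟨b, right_mem_language (v := [a']) (by simpa using hv), rfl⟩
    · rintro ⟨b, hb, rfl⟩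
      obtain ⟨a', ha'⟩ := exists_cons_mem hG hb
      have h1 : a' ∈ Lext u w := left_mem_language (w := [b]) (by simpa using ha')
      rw [ha] at h1
      obtain rfl := h1
      exact ⟨ha', _, b, rfl⟩
  rw [this, Set.ncard_image_of_injective]
  exact fun b b' h => by simpa using h

theorem ncard_Bext_of_ncard_Rext_eq_one {w : List A}
    (h : (Rext u w).ncard = 1) : (Bext u w).ncard = (Lext u w).ncard := by
  obtain ⟨b, hb⟩ := Set.ncard_eq_one.1 h
  have : Bext u w = (fun a => a :: (w ++ [b])) '' Lext u w := by
    ext v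
    constructor
    · rintro ⟨hv, a, b', rfl⟩
      have h1 : b' ∈ Rext u w := right_mem_language (v := [a]) (by simpa using hv)
      rw [hb] at h1
      obtain rfl := h1
      exact ⟨a, left_mem_language (w := [b']) (by simpa using hv), rfl⟩
    · rintro ⟨a, ha, rfl⟩
      obtain ⟨b', hb'⟩ := exists_singleton_append_mem ha
      have h1 : b' ∈ Rext u w := right_mem_language (v := [a]) (by simpa using hb')
      rw [hb] at h1
      obtain rfl := h1
      exact ⟨by simpa using hb', a, _, rfl⟩
  rw [this, Set.ncard_image_of_injective]
  exact fun b b' h => by simpa using h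

theorem bilateralExcess_eq_zero_of_not_isBispecial [Finite A] (hG : ClosedUnder u G) {w : List A}
    (hw : w ∈ language u) (h : ¬ IsBispecial u w) : bilateralExcess u G w = 0 := by
  have hone : (Lext u w).ncard = 1 ∨ (Rext u w).ncard = 1 := by
    by_cases h1 : 2 ≤ (Lext u w).ncard
    · exact Or.inr (ncard_eq_one_of_lt_two (Rext_nonempty hw) fun h2 => h ⟨⟨hw, h1⟩, hw, h2⟩)
    · exact Or.inl (ncard_eq_one_of_lt_two (Lext_nonempty hG hw) h1)
  have hb : bilateralOrder u w = 0 := by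
    unfold bilateralOrder
    rcases hone with h1 | h1
    · have := ncard_Bext_of_ncard_Lext_eq_one hG h1
      omega
    · have := ncard_Bext_of_ncard_Rext_eq_one h1
      omega
  unfold bilateralExcess
  rw [hb]
  by_cases hp : G.IsPalindrome w
  · have heq := ncard_Lext_eq_ncard_Rext hG hp
    have hL : (Lext u w).ncard = 1 := by omega
    have hB := ncard_Bext_of_ncard_Lext_eq_one hG hL
    obtain ⟨v, hv⟩ := Set.ncard_eq_one.1 (hB.trans (heq.symm.trans hL))
    have hvm : v ∈ Bext u w := hv ▸ rfl
    obtain ⟨Θ, hΘ, hΘw⟩ := hp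
    have hΘv : Θ v = v := by
      have := apply_mem_Bext hG hΘ.1 hvm
      rwa [hΘw, hv] at this
    have : palindromicExtensions u G w = {v} := by
      rw [← hv]
      refine Set.Subset.antisymm (Set.sep_subset _ _) fun x hx => ⟨hx, Θ, hΘ, ?_⟩
      rw [hv] at hx
      obtain rfl := hx
      exact hΘv
    rw [this, if_pos ⟨Θ, hΘ, hΘw⟩]
    simp
  · rw [palindromicExtensions_eq_empty hp, if_neg hp]
    simp

/-- The classes of the extensions `aw` and `wb` span in the quotient of the Rauzy graph of order
`|w| + 1` the classes of the words `awb`; in a balanced order these are the vertices and edges of a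
forest. -/
theorem bilateralExcess_nonpos [Finite A] [Nontrivial A] (hG : ClosedUnder u G)
    (hN : IsDistinguishing u G N) {w : List A} (hw : w ∈ language u) (hl : N ≤ w.length)
    (hb : IsBalanced u G (w.length + 1)) : bilateralExcess u G w ≤ 0 := by
  set W := G.orbit '' (leftExtensions u w ∪ rightExtensions u w) with hW
  set X := {v ∈ Bext u w | ¬ G.IsPalindrome v} with hX
  set K := G.orbit '' X with hK
  have hXfin : X.Finite := (finite_Bext w).subset (Set.sep_subset _ _)
  have hcount : K.ncard + 1 ≤ W.ncard := by
    refine hb.ncard_add_one_le hG hN (by omega) ?_ ?_ ?_ ?_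
    · exact Set.image_mono (Set.union_subset (Set.sep_subset _ _) (Set.sep_subset _ _))
    · obtain ⟨a, ha⟩ := Lext_nonempty hG hw
      exact ⟨_, _, Or.inl (by rw [leftExtensions_eq]; exact ⟨a, ha, rfl⟩), rfl⟩
    · refine Set.image_mono fun v hv => ?_
      have := hv.1
      rw [Bext_eq] at this
      exact ⟨this.1, hv.2⟩
    · rintro i ⟨v, ⟨⟨hv, a, b, rfl⟩, -⟩, hvi⟩
      obtain ⟨μ, hμ, h⟩ := orbit_eq_iff.1 hvi.symm
      have h1 := ends_apply G hμ (n := w.length + 1) (e := a :: (w ++ [b])) (by simp)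
      have h2 : source G (w.length + 1) (a :: (w ++ [b])) = G.orbit (a :: w) := by
        simp [source]
      have h3 : target G (w.length + 1) (a :: (w ++ [b])) = G.orbit (w ++ [b]) := by
        simp [target]
      rw [← h, source_factorAt, target_factorAt, h2, h3] at h1
      have h4 : G.orbit (a :: w) ∈ W := by
        refine ⟨_, Or.inl ?_, rfl⟩
        rw [leftExtensions_eq]
        exact ⟨a, left_mem_language (w := [b]) (by simpa using hv), rfl⟩
      have h5 : G.orbit (w ++ [b]) ∈ W := by
        refine ⟨_, Or.inr ?_, rfl⟩
        rw [rightExtensions_eq]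
        exact ⟨b, right_mem_language (v := [a]) (by simpa using hv), rfl⟩
      rcases h1 with ⟨h6, h7⟩ | ⟨h6, h7⟩
      · exact ⟨h6 ▸ h4, h7 ▸ h5⟩
      · exact ⟨h6 ▸ h5, h7 ▸ h4⟩
  have hsplit : X.ncard + (palindromicExtensions u G w).ncard = (Bext u w).ncard :=
    ncard_sep_not_add (finite_Bext w) _
  unfold bilateralExcess bilateralOrder
  by_cases hp : G.IsPalindrome w
  · have hW' : W.ncard ≤ (Lext u w).ncard := by
      rw [hW, orbit_image_extensions_of_isPalindrome hG hp, ← ncard_leftExtensions]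
      exact Set.ncard_image_le (finite_leftExtensions w)
    have heq := ncard_Lext_eq_ncard_Rext hG hp
    obtain ⟨Θ, hΘ, hΘw⟩ := hp
    -- Only the identity and `Θ` fix `w`, so a class contains at most two of the words `awb`.
    have hX2 : X.ncard ≤ 2 * K.ncard := by
      classical
      lift X to Finset (List A) using hXfin with X'
      rw [hK, ← Finset.coe_image, Set.ncard_coe_finset, Set.ncard_coe_finset]
      refine Finset.card_le_mul_card_image X' 2 fun O hO => ?_
      obtain ⟨v, hv, rfl⟩ := Finset.mem_image.1 hO
      refine (Finset.card_le_card (t := {v, Θ v}) fun x hx => ?_).trans Finset.card_le_two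
      obtain ⟨hxX, hxv⟩ := Finset.mem_filter.1 hx
      obtain ⟨μ, hμ, rfl⟩ := orbit_eq_iff.1 hxv
      have hv' : v ∈ Bext u w := (hX.le hv).1
      have hx' : μ v ∈ Bext u w := (hX.le hxX).1
      have hfix := apply_eq_of_mem_Bext hμ hv' hx'
      rcases eq_one_or_of_apply_eq hN hw hl hμ hfix with rfl | h
      · simp
      · rw [antimorphism_ext hN hw hl h hΘ (hfix.trans hΘw.symm)]
        simp
    rw [if_pos ⟨Θ, hΘ, hΘw⟩]
    omega
  · have hW' : W.ncard ≤ (Lext u w).ncard + (Rext u w).ncard := by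
      rw [← ncard_leftExtensions, ← ncard_rightExtensions]
      exact (Set.ncard_image_le ((finite_leftExtensions w).union (finite_rightExtensions w))).trans
        (Set.ncard_union_le _ _)
    have hXK : K.ncard = X.ncard := by
      refine Set.InjOn.ncard_image fun v hv v' hv' h => ?_
      obtain ⟨μ, hμ, rfl⟩ := orbit_eq_iff.1 h
      have hfix := apply_eq_of_mem_Bext hμ hv'.1 hv.1
      rcases eq_one_or_of_apply_eq hN hw hl hμ hfix with rfl | h
      · rfl
      · exact absurd ⟨μ, h, hfix⟩ hp
    rw [if_neg hp]
    omega

end Extensions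

/-! ### The second difference of the complexity -/

section SecondDifference

variable {A : Type*} {G : SymmetryGroup A} {u : ℕ → A} {N : ℕ}

theorem ncard_eq_sum_fibers {X Y : Type*} {T : Set X} (hT : T.Finite) {S : Finset Y} (f : X → Y)
    (hf : ∀ x ∈ T, f x ∈ S) : T.ncard = ∑ y ∈ S, {x ∈ T | f x = y}.ncard := by
  classical
  lift T to Finset X using hT
  rw [Set.ncard_coe_finset, Finset.card_eq_sum_card_fiberwise (f := f) (t := S) hf]
  refine Finset.sum_congr rfl fun y _ => ?_
  rw [← Set.ncard_coe_finset, Finset.coe_filter]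
  rfl

variable [Finite A]

/-- The factors of length `n` as a finset. -/
noncomputable def factorsFinset (u : ℕ → A) (n : ℕ) : Finset (List A) :=
  (finite_factors (u := u) n).toFinset

theorem mem_factorsFinset {n : ℕ} {w : List A} : w ∈ factorsFinset u n ↔ w ∈ factors u n :=
  Set.Finite.mem_toFinset _

theorem card_factorsFinset (n : ℕ) : (factorsFinset u n).card = complexity u n :=
  (Set.ncard_eq_toFinset_card _ _).symm

theorem sum_ncard_Lext (n : ℕ) :
    ∑ w ∈ factorsFinset u n, (Lext u w).ncard = complexity u (n + 1) := by
  rw [complexity, ncard_eq_sum_fibers (finite_factors (n + 1)) (S := factorsFinset u n)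
    (List.drop 1)]
  · refine Finset.sum_congr rfl fun w hw => ?_
    rw [← ncard_leftExtensions, leftExtensions, (mem_factorsFinset.1 hw).2]
  · intro v hv
    exact mem_factorsFinset.2 ⟨drop_mem_language hv.1 1, by rw [List.length_drop, hv.2]; omega⟩

theorem sum_ncard_Rext (n : ℕ) :
    ∑ w ∈ factorsFinset u n, (Rext u w).ncard = complexity u (n + 1) := by
  rw [complexity, ncard_eq_sum_fibers (finite_factors (n + 1)) (S := factorsFinset u n)
    (List.take n)]
  · refine Finset.sum_congr rfl fun w hw => ?_
    rw [← ncard_rightExtensions, rightExtensions, (mem_factorsFinset.1 hw).2]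
  · intro v hv
    exact mem_factorsFinset.2 ⟨take_mem_language hv.1 n, by rw [List.length_take, hv.2]; omega⟩

theorem middle_mem_factorsFinset {n : ℕ} {v : List A} (hv : v ∈ factors u (n + 2)) :
    (v.drop 1).take n ∈ factorsFinset u n := by
  refine mem_factorsFinset.2 ⟨take_mem_language (drop_mem_language hv.1 1) n, ?_⟩
  rw [List.length_take, List.length_drop, hv.2]
  omega

theorem sum_ncard_Bext (n : ℕ) :
    ∑ w ∈ factorsFinset u n, (Bext u w).ncard = complexity u (n + 2) := by
  rw [complexity, ncard_eq_sum_fibers (finite_factors (n + 2)) (S := factorsFinset u n)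
    (fun v => (v.drop 1).take n) fun v hv => middle_mem_factorsFinset hv]
  refine Finset.sum_congr rfl fun w hw => ?_
  rw [Bext_eq, (mem_factorsFinset.1 hw).2]

theorem sum_ncard_palindromicExtensions (n : ℕ) :
    ∑ w ∈ factorsFinset u n, (palindromicExtensions u G w).ncard
      = (palindromes u G (n + 2)).ncard := by
  rw [ncard_eq_sum_fibers ((finite_factors (n + 2)).subset (Set.sep_subset _ _))
    (T := palindromes u G (n + 2)) (S := factorsFinset u n)
    (fun v => (v.drop 1).take n) fun v hv => middle_mem_factorsFinset hv.1]
  refine Finset.sum_congr rfl fun w hw => ?_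
  rw [palindromicExtensions, Bext_eq, (mem_factorsFinset.1 hw).2]
  congr 1
  ext v
  simp only [palindromes, Set.mem_ofPred_eq]
  tauto

theorem sum_isPalindrome (n : ℕ) [DecidablePred G.IsPalindrome] :
    ∑ w ∈ factorsFinset u n, (if G.IsPalindrome w then (1 : ℤ) else 0)
      = (palindromes u G n).ncard := by
  rw [Finset.sum_ite, Finset.sum_const_zero, add_zero, Finset.sum_const, nsmul_one,
    ← Set.ncard_coe_finset, Finset.coe_filter]
  simp only [mem_factorsFinset]
  rfl

theorem sum_bilateralExcess (n : ℕ) :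
    ∑ w ∈ factorsFinset u n, bilateralExcess u G w
      = deltaComplexity u (n + 1) - deltaComplexity u n
        - (palindromes u G (n + 2)).ncard + (palindromes u G n).ncard := by
  classical
  simp only [bilateralExcess, bilateralOrder, Finset.sum_add_distrib, Finset.sum_sub_distrib]
  have h0 := sum_isPalindrome (u := u) (G := G) n
  have h1 := sum_ncard_Lext (u := u) n
  have h2 := sum_ncard_Rext (u := u) n
  have h3 := sum_ncard_Bext (u := u) n
  have h4 := sum_ncard_palindromicExtensions (u := u) (G := G) n
  rw [← Nat.cast_sum, ← Nat.cast_sum, ← Nat.cast_sum, ← Nat.cast_sum, h1, h2, h3, h4, h0,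
    Finset.sum_const, card_factorsFinset, nsmul_one, deltaComplexity, deltaComplexity]
  ring

theorem isBalanced_succ_iff {n : ℕ} (hb : IsBalanced u G n) :
    IsBalanced u G (n + 1) ↔ ∑ w ∈ factorsFinset u n, bilateralExcess u G w = 0 := by
  rw [sum_bilateralExcess]
  unfold IsBalanced at *
  rw [show n + 1 + 1 = n + 2 from rfl]
  omega

/-- All orders from `N` on are balanced if and only if the order `N` is balanced and the bilateral
orders of long factors are as small as the palindromic extensions permit. -/
theorem forall_isBalanced_iff [Nontrivial A] (hG : ClosedUnder u G)
    (hN : IsDistinguishing u G N) :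
    (∀ n, N ≤ n → IsBalanced u G n) ↔
      (∀ w ∈ language u, N ≤ w.length → bilateralExcess u G w = 0) ∧ IsBalanced u G N := by
  constructor
  · refine fun h => ⟨fun w hw hl => ?_, h N le_rfl⟩
    have h1 := (isBalanced_succ_iff (h w.length hl)).1 (h (w.length + 1) (by omega))
    refine (Finset.sum_eq_zero_iff_of_nonpos fun v hv => ?_).1 h1 w
      (mem_factorsFinset.2 ⟨hw, rfl⟩)
    have hv' := mem_factorsFinset.1 hv
    exact bilateralExcess_nonpos hG hN hv'.1 (hv'.2 ▸ hl)
      (hv'.2.symm ▸ h (w.length + 1) (by omega))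
  · rintro ⟨h, hb⟩ n hn
    induction n, hn using Nat.le_induction with
    | base => exact hb
    | succ n hn ih =>
      refine (isBalanced_succ_iff ih).2 (Finset.sum_eq_zero fun w hw => ?_)
      have hw' := mem_factorsFinset.1 hw
      exact h w hw'.1 (hw'.2.symm ▸ hn)

end SecondDifference

/-! ### Counting palindromes antimorphism by antimorphism -/

section PalindromicComplexity

variable {A : Type*} {G : SymmetryGroup A} {u : ℕ → A} {N : ℕ}

theorem finite_antimorphisms (G : SymmetryGroup A) : G.antimorphisms.Finite := by
  have := G.finite_toSubgroup
  exact (Set.toFinite (G.toSubgroup : Set (Equiv.Perm (List A)))).subset fun μ h => h.1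

theorem finite_involutiveAntimorphisms (G : SymmetryGroup A) :
    G.involutiveAntimorphisms.Finite :=
  (finite_antimorphisms G).subset (Set.sep_subset _ _)

variable [Finite A]

/-- In long factors the sets of palindromes for different antimorphisms are disjoint. -/
theorem finsum_palindromicComplexity (hN : IsDistinguishing u G N) {n : ℕ} (hn : N ≤ n)
    {S : Set (Equiv.Perm (List A))} (hS : S ⊆ G.antimorphisms)
    (hS' : G.involutiveAntimorphisms ⊆ S) :
    ∑ᶠ Θ ∈ S, palindromicComplexity u Θ n = (palindromes u G n).ncard := by
  classical
  have hSfin := (finite_antimorphisms G).subset hS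
  have hpal : palindromes u G n = ⋃ Θ ∈ S, {w | w ∈ factors u n ∧ Θ w = w} := by
    ext w
    simp only [palindromes, Set.mem_ofPred_eq, Set.mem_iUnion, exists_prop]
    constructor
    · rintro ⟨hw, Θ, hΘ, h⟩
      refine ⟨Θ, hS' ⟨hΘ, fun v => ?_⟩, hw, h⟩
      exact Equiv.Perm.ext_iff.1 (mul_self_of_apply_eq hN hw.1 (hw.2.symm ▸ hn) hΘ h) v
    · rintro ⟨Θ, hΘ, hw, h⟩
      exact ⟨hw, Θ, hS hΘ, h⟩
  have hdisj : S.PairwiseDisjoint fun Θ : Equiv.Perm (List A) =>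
      {w | w ∈ factors u n ∧ Θ w = w} := by
    intro Θ hΘ Θ' hΘ' hne
    refine Set.disjoint_left.2 fun w hw hw' => hne ?_
    exact antimorphism_ext hN hw.1.1 (hw.1.2.symm ▸ hn) (hS hΘ) (hS hΘ') (hw.2.trans hw'.2.symm)
  rw [hpal, hSfin.ncard_biUnion (fun Θ _ => (finite_factors n).subset (Set.sep_subset _ _)) hdisj]
  rfl

theorem isBalanced_iff_finsum (hN : IsDistinguishing u G N) :
    IsBalanced u G N ↔ deltaComplexity u N + (G.card : ℤ) =
      ∑ᶠ Θ ∈ G.involutiveAntimorphisms,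
        ((palindromicComplexity u Θ N : ℤ) + palindromicComplexity u Θ (N + 1)) := by
  have hsub : G.involutiveAntimorphisms ⊆ G.antimorphisms := Set.sep_subset _ _
  have hfin := finite_involutiveAntimorphisms G
  have key : ∀ n, N ≤ n → ∑ᶠ Θ ∈ G.involutiveAntimorphisms, (palindromicComplexity u Θ n : ℤ)
      = (palindromes u G n).ncard := by
    intro n hn
    rw [← finsum_palindromicComplexity hN hn hsub subset_rfl]
    exact ((Nat.castAddMonoidHom ℤ).map_finsum_mem _ hfin).symm
  rw [finsum_mem_add_distrib hfin, key N le_rfl, key (N + 1) (Nat.le_succ N)]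
  rfl

end PalindromicComplexity

/-! ### Special factors and directed edges -/

section DirectedEdges

variable {A : Type*} {G : SymmetryGroup A} {u : ℕ → A} {N : ℕ}

theorem isLeftSpecial_iff [Finite A] {w : List A} :
    IsLeftSpecial u w ↔ ∃ a b, a :: w ∈ language u ∧ b :: w ∈ language u ∧ a ≠ b := by
  refine ⟨fun h => ?_, fun ⟨a, b, ha, hb, hab⟩ => ⟨right_mem_language (v := [a]) ha, ?_⟩⟩
  · obtain ⟨a, b, ha, hb, hab⟩ := (Set.one_lt_ncard_iff (Set.toFinite _)).1 h.2
    exact ⟨a, b, ha, hb, hab⟩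
  · exact (Set.one_lt_ncard_iff (Set.toFinite _)).2 ⟨a, b, ha, hb, hab⟩

theorem isRightSpecial_iff [Finite A] {w : List A} :
    IsRightSpecial u w ↔ ∃ a b, w ++ [a] ∈ language u ∧ w ++ [b] ∈ language u ∧ a ≠ b := by
  refine ⟨fun h => ?_, fun ⟨a, b, ha, hb, hab⟩ => ⟨left_mem_language ha, ?_⟩⟩
  · obtain ⟨a, b, ha, hb, hab⟩ := (Set.one_lt_ncard_iff (Set.toFinite _)).1 h.2
    exact ⟨a, b, ha, hb, hab⟩
  · exact (Set.one_lt_ncard_iff (Set.toFinite _)).2 ⟨a, b, ha, hb, hab⟩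

theorem IsSpecial.mem_language {w : List A} (h : IsSpecial u w) : w ∈ language u :=
  h.elim (fun h => h.1) fun h => h.1

theorem IsSpecial.apply [Finite A] (hG : ClosedUnder u G) {μ : Equiv.Perm (List A)}
    (hμ : μ ∈ G.toSubgroup) {w : List A} (h : IsSpecial u w) : IsSpecial u (μ w) := by
  have hne : ∀ {a b a' b' : A}, μ [a] = [a'] → μ [b] = [b'] → a ≠ b → a' ≠ b' := by
    rintro a b a' b' ha hb hab rfl
    exact hab (by simpa using μ.injective (ha.trans hb.symm))
  rcases h with h | h
  · obtain ⟨a, b, ha, hb, hab⟩ := isLeftSpecial_iff.1 h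
    obtain ⟨a', ha'⟩ := exists_apply_singleton hμ a
    obtain ⟨b', hb'⟩ := exists_apply_singleton hμ b
    have h1 := hG _ ha _ hμ
    have h2 := hG _ hb _ hμ
    rw [← List.singleton_append] at h1 h2
    rcases G.isMorphism_or_isAntimorphism μ hμ with hm | hm <;> rw [hm, ha'] at h1 <;>
      rw [hm, hb'] at h2
    · exact Or.inl (isLeftSpecial_iff.2 ⟨a', b', h1, h2, hne ha' hb' hab⟩)
    · exact Or.inr (isRightSpecial_iff.2 ⟨a', b', h1, h2, hne ha' hb' hab⟩)
  · obtain ⟨a, b, ha, hb, hab⟩ := isRightSpecial_iff.1 h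
    obtain ⟨a', ha'⟩ := exists_apply_singleton hμ a
    obtain ⟨b', hb'⟩ := exists_apply_singleton hμ b
    have h1 := hG _ ha _ hμ
    have h2 := hG _ hb _ hμ
    rcases G.isMorphism_or_isAntimorphism μ hμ with hm | hm <;> rw [hm, ha'] at h1 <;>
      rw [hm, hb'] at h2
    · exact Or.inr (isRightSpecial_iff.2 ⟨a', b', h1, h2, hne ha' hb' hab⟩)
    · exact Or.inl (isLeftSpecial_iff.2 ⟨a', b', h1, h2, hne ha' hb' hab⟩)

theorem isSpecial_apply_iff [Finite A] (hG : ClosedUnder u G) {μ : Equiv.Perm (List A)}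
    (hμ : μ ∈ G.toSubgroup) {w : List A} : IsSpecial u (μ w) ↔ IsSpecial u w := by
  refine ⟨fun h => ?_, fun h => h.apply hG hμ⟩
  simpa using h.apply hG (G.toSubgroup.inv_mem hμ)

theorem eq_of_append_mem [Finite A] {w : List A} (h : ¬ IsSpecial u w) {a b : A}
    (ha : w ++ [a] ∈ language u) (hb : w ++ [b] ∈ language u) : a = b := by
  by_contra hab
  exact h (Or.inr (isRightSpecial_iff.2 ⟨a, b, ha, hb, hab⟩))

theorem eq_of_cons_mem [Finite A] {w : List A} (h : ¬ IsSpecial u w) {a b : A}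
    (ha : a :: w ∈ language u) (hb : b :: w ∈ language u) : a = b := by
  by_contra hab
  exact h (Or.inl (isLeftSpecial_iff.2 ⟨a, b, ha, hb, hab⟩))

/-- A factor that is not special has only one continuation. -/
theorem factorAt_succ_eq [Finite A] {n p q : ℕ} (h : ¬ IsSpecial u (factorAt u p n))
    (hpq : factorAt u p n = factorAt u q n) :
    factorAt u p (n + 1) = factorAt u q (n + 1) := by
  have h1 := factorAt_mem u p (n + 1)
  have h2 := factorAt_mem u q (n + 1)
  rw [factorAt_succ] at h1 h2
  rw [← hpq] at h2
  rw [factorAt_succ, factorAt_succ, ← hpq, eq_of_append_mem h h1 h2]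

theorem mem_directedEdges_iff {n : ℕ} {e : List A} :
    e ∈ directedEdges u n ↔ ∃ i k, 1 ≤ k ∧ e = factorAt u i (n + k) ∧
      IsSpecial u (factorAt u i n) ∧ IsSpecial u (factorAt u (i + k) n) ∧
      ∀ t, 0 < t → t < k → ¬ IsSpecial u (factorAt u (i + t) n) := by
  have key : ∀ i k t, t ≤ k →
      ((factorAt u i (n + k)).drop t).take n = factorAt u (i + t) n := by
    intro i k t ht
    rw [drop_factorAt u i (by omega), take_factorAt u _ (by omega)]
  constructor
  · rintro ⟨he, hl, hs, ht, hi⟩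
    obtain ⟨i, hie⟩ := exists_factorAt_of_mem he
    obtain ⟨k, hk⟩ := Nat.exists_eq_add_of_le (show n ≤ e.length by omega)
    rw [hk] at hie
    subst hie
    rw [length_factorAt, Nat.add_sub_cancel_left] at ht hi
    rw [length_factorAt] at hl
    rw [take_factorAt u i (by omega)] at hs
    rw [drop_factorAt u i (by omega), Nat.add_sub_cancel] at ht
    exact ⟨i, k, by omega, rfl, hs, ht, fun t h0 h1 => key i k t h1.le ▸ hi t h0 h1⟩
  · rintro ⟨i, k, hk, rfl, hs, ht, hi⟩
    refine ⟨factorAt_mem u _ _, by rw [length_factorAt]; omega, ?_, ?_, ?_⟩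
    · rwa [take_factorAt u i (by omega)]
    · rwa [length_factorAt, Nat.add_sub_cancel_left, drop_factorAt u i (by omega),
        Nat.add_sub_cancel]
    · rw [length_factorAt, Nat.add_sub_cancel_left]
      exact fun t h0 h1 => (key i k t h1.le).symm ▸ hi t h0 h1

theorem apply_mem_directedEdges [Finite A] (hG : ClosedUnder u G) {μ : Equiv.Perm (List A)}
    (hμ : μ ∈ G.toSubgroup) {n : ℕ} {e : List A} (he : e ∈ directedEdges u n) :
    μ e ∈ directedEdges u n := by
  obtain ⟨heL, hl, hs, ht, hi⟩ := he
  refine ⟨hG e heL μ hμ, by rwa [length_apply G hμ], ?_⟩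
  rw [length_apply G hμ]
  rcases G.isMorphism_or_isAntimorphism μ hμ with h | h
  · refine ⟨?_, ?_, fun i h0 h1 => ?_⟩
    · rw [take_apply_of_isMorphism hμ h, isSpecial_apply_iff hG hμ]
      exact hs
    · rw [drop_apply_of_isMorphism hμ h _ (by omega), isSpecial_apply_iff hG hμ]
      exact ht
    · rw [drop_apply_of_isMorphism hμ h _ (by omega), take_apply_of_isMorphism hμ h,
        isSpecial_apply_iff hG hμ]
      exact hi i h0 h1
  · refine ⟨?_, ?_, fun i h0 h1 => ?_⟩
    · rw [take_apply_of_isAntimorphism hμ h _ (by omega), isSpecial_apply_iff hG hμ]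
      exact ht
    · rw [drop_apply_of_isAntimorphism hμ h _ (by omega), isSpecial_apply_iff hG hμ,
        show e.length - (e.length - n) = n by omega]
      exact hs
    · rw [drop_apply_of_isAntimorphism hμ h _ (by omega),
        take_apply_of_isAntimorphism hμ h _ (by rw [List.length_take]; omega),
        isSpecial_apply_iff hG hμ, List.length_take, List.drop_take,
        show min (e.length - i) e.length - n = e.length - n - i by omega,
        show e.length - i - (e.length - n - i) = n by omega]
      exact hi _ (by omega) (by omega)

/-- Going forward from a factor of length `n + 1`, the word is determined up to the next occurrence
of a special factor of length `n`. -/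
theorem factorAt_eq_of_next_special [Finite A] {n p q k l : ℕ} (hk : 1 ≤ k) (hl : 1 ≤ l)
    (hpq : factorAt u p (n + 1) = factorAt u q (n + 1))
    (hp : ∀ t, 0 < t → t < k → ¬ IsSpecial u (factorAt u (p + t) n))
    (hpk : IsSpecial u (factorAt u (p + k) n))
    (hq : ∀ t, 0 < t → t < l → ¬ IsSpecial u (factorAt u (q + t) n))
    (hql : IsSpecial u (factorAt u (q + l) n)) :
    k = l ∧ factorAt u p (n + k) = factorAt u q (n + k) := by
  have hsuffix : ∀ t, factorAt u p (n + t) = factorAt u q (n + t) →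
      factorAt u (p + t) n = factorAt u (q + t) n := by
    intro t ht
    have := congrArg (List.drop t) ht
    rwa [drop_factorAt u p (by omega), drop_factorAt u q (by omega), Nat.add_sub_cancel] at this
  have key : ∀ t, 1 ≤ t → t ≤ k → t ≤ l → factorAt u p (n + t) = factorAt u q (n + t) := by
    intro t ht
    induction t, ht using Nat.le_induction with
    | base => exact fun _ _ => hpq
    | succ t ht ih =>
      intro htk htl
      have h1 := ih (by omega) (by omega)
      have h2 := factorAt_succ_eq (hp t (by omega) (by omega)) (hsuffix t h1)
      rw [factorAt_succ, factorAt_succ, hsuffix t h1, List.append_cancel_left_eq] at h2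
      rw [← add_assoc, factorAt_succ, factorAt_succ, h1,
        show p + (n + t) = p + t + n by omega, show q + (n + t) = q + t + n by omega, h2]
  have hkl : k = l := by
    rcases lt_trichotomy k l with h | h | h
    · exact absurd (hsuffix k (key k hk le_rfl h.le) ▸ hpk) (hq k (by omega) h)
    · exact h
    · exact absurd (hsuffix l (key l hl h.le le_rfl) ▸ hql) (hp l (by omega) h)
  exact ⟨hkl, key k hk le_rfl hkl.le⟩

/-- The special factors of length `n`. -/
def specialFactors (u : ℕ → A) (n : ℕ) : Set (List A) :=
  {w ∈ factors u n | IsSpecial u w}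

theorem exists_next_special (hG : ClosedUnder u G) {n : ℕ} (hS : (specialFactors u n).Nonempty)
    (p : ℕ) : ∃ k, 1 ≤ k ∧ IsSpecial u (factorAt u (p + k) n) ∧
      ∀ t, 0 < t → t < k → ¬ IsSpecial u (factorAt u (p + t) n) := by
  classical
  have hex : ∃ k, 1 ≤ k ∧ IsSpecial u (factorAt u (p + k) n) := by
    obtain ⟨w, hw, hws⟩ := hS
    obtain ⟨j, hj, hjw⟩ := exists_ge_factorAt_of_mem hG hw.1 (p + 1)
    rw [hw.2] at hjw
    refine ⟨j - p, by omega, ?_⟩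
    rwa [show p + (j - p) = j by omega, hjw]
  refine ⟨Nat.find hex, (Nat.find_spec hex).1, (Nat.find_spec hex).2, fun t h0 h1 h2 => ?_⟩
  exact Nat.find_min hex h1 ⟨h0, h2⟩

theorem exists_previous_special {n p : ℕ}
    (hp : ∃ j ≤ p, IsSpecial u (factorAt u j n)) :
    ∃ s ≤ p, IsSpecial u (factorAt u (p - s) n) ∧
      ∀ t < s, ¬ IsSpecial u (factorAt u (p - t) n) := by
  classical
  have hex : ∃ s, s ≤ p ∧ IsSpecial u (factorAt u (p - s) n) := by
    obtain ⟨j, hj, h⟩ := hp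
    exact ⟨p - j, by omega, by rwa [show p - (p - j) = j by omega]⟩
  refine ⟨Nat.find hex, (Nat.find_spec hex).1, (Nat.find_spec hex).2, fun t h1 h2 => ?_⟩
  have := (Nat.find_spec hex).1
  exact Nat.find_min hex h1 ⟨by omega, h2⟩

/-- A directed edge is determined by its first `n + 1` letters. -/
theorem bijOn_take_directedEdges [Finite A] (hG : ClosedUnder u G) (n : ℕ) :
    Set.BijOn (List.take (n + 1)) (directedEdges u n)
      {v ∈ factors u (n + 1) | IsSpecial u (v.take n)} := by
  refine ⟨fun e he => ?_, fun e he e' he' h => ?_, fun v hv => ?_⟩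
  · refine ⟨⟨take_mem_language he.1 _, ?_⟩, ?_⟩
    · rw [List.length_take]
      have := he.2.1
      omega
    · rw [List.take_take, min_eq_left (Nat.le_succ n)]
      exact he.2.2.1
  · obtain ⟨i, k, hk, rfl, -, ht, hi⟩ := mem_directedEdges_iff.1 he
    obtain ⟨i', k', hk', rfl, -, ht', hi'⟩ := mem_directedEdges_iff.1 he'
    rw [take_factorAt u i (by omega), take_factorAt u i' (by omega)] at h
    obtain ⟨rfl, h2⟩ := factorAt_eq_of_next_special hk hk' h hi ht hi' ht'
    exact h2
  · obtain ⟨i, rfl⟩ := exists_factorAt_of_mem_factors hv.1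
    have hs := hv.2
    rw [take_factorAt u i (by omega)] at hs
    obtain ⟨k, hk, h1, h2⟩ := exists_next_special hG ⟨_, factorAt_mem_factors u i n, hs⟩ i
    exact ⟨_, mem_directedEdges_iff.2 ⟨i, k, hk, rfl, hs, h1, h2⟩, take_factorAt u i (by omega)⟩

theorem finite_directedEdges [Finite A] (hG : ClosedUnder u G) (n : ℕ) :
    (directedEdges u n).Finite :=
  (bijOn_take_directedEdges hG n).finite_iff_finite.2
    ((finite_factors (n + 1)).subset (Set.sep_subset _ _))

theorem ncard_directedEdges_add [Finite A] (hG : ClosedUnder u G) (n : ℕ) :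
    (directedEdges u n).ncard + complexity u n
      = complexity u (n + 1) + (specialFactors u n).ncard := by
  have h1 := ncard_sep_not_add (finite_factors (u := u) n) (IsSpecial u)
  have h2 := ncard_sep_not_add (finite_factors (u := u) (n + 1))
    (fun v => IsSpecial u (v.take n))
  have h3 : Set.BijOn (List.take n) {v ∈ factors u (n + 1) | ¬ IsSpecial u (v.take n)}
      {w ∈ factors u n | ¬ IsSpecial u w} := by
    refine ⟨fun v hv => ⟨⟨take_mem_language hv.1.1 n, ?_⟩, hv.2⟩, fun v hv v' hv' h => ?_,
      fun w hw => ?_⟩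
    · rw [List.length_take, hv.1.2]
      omega
    · obtain ⟨i, rfl⟩ := exists_factorAt_of_mem_factors hv.1
      obtain ⟨i', rfl⟩ := exists_factorAt_of_mem_factors hv'.1
      have hs := hv.2
      rw [take_factorAt u i (by omega)] at hs h
      rw [take_factorAt u i' (by omega)] at h
      exact factorAt_succ_eq hs h
    · obtain ⟨i, rfl⟩ := exists_factorAt_of_mem_factors hw.1
      have := take_factorAt u i (Nat.le_succ n)
      exact ⟨_, ⟨factorAt_mem_factors u i (n + 1), this.symm ▸ hw.2⟩, this⟩
  have h4 := h3.ncard_eq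
  have h5 := (bijOn_take_directedEdges hG n).ncard_eq
  unfold specialFactors complexity
  omega

/-! ### Palindromic directed edges -/

/-- An antimorphism exchanges prefixes and suffixes: two words with a common suffix have images
with a common prefix. -/
theorem eq_of_drop_eq {Θ : Equiv.Perm (List A)} (hΘ : Θ ∈ G.antimorphisms) {x y : List A} {a : ℕ}
    (hl : x.length = y.length) (ha : 2 * a ≤ x.length) (h : x.drop a = y.drop a)
    (hxy : Θ x = x ∧ Θ y = y ∨ Θ x = y ∧ Θ y = x) : x = y := by
  have h1 : x.drop (x.length - a) = y.drop (x.length - a) := by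
    have := congrArg (List.drop (x.length - a - a)) h
    rwa [List.drop_drop, List.drop_drop, show a + (x.length - a - a) = x.length - a by omega]
      at this
  have h2 : (Θ x).take a = (Θ y).take a := by
    rw [take_apply_of_isAntimorphism hΘ.1 hΘ.2 x (by omega),
      take_apply_of_isAntimorphism hΘ.1 hΘ.2 y (by omega), ← hl, h1]
  have h3 : x.take a = y.take a := by
    rcases hxy with ⟨h4, h5⟩ | ⟨h4, h5⟩ <;> rw [h4, h5] at h2
    · exact h2
    · exact h2.symm
  rw [← List.take_append_drop a x, ← List.take_append_drop a y, h3, h]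

theorem apply_infix {Θ : Equiv.Perm (List A)} (hΘ : Θ ∈ G.antimorphisms) (e : List A) {a b : ℕ}
    (h : a + b ≤ e.length) :
    Θ ((e.drop a).take b) = ((Θ e).drop (e.length - a - b)).take b := by
  rw [drop_apply_of_isAntimorphism hΘ.1 hΘ.2 e (by omega),
    take_apply_of_isAntimorphism hΘ.1 hΘ.2 _ (by rw [List.length_take]; omega), List.length_take,
    List.drop_take]
  congr 2 <;> [skip; congr 1] <;> omega

/-- The central factor of length `n` or `n + 1` of a word of length at least `n`. -/
def center (n : ℕ) (e : List A) : List A :=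
  (e.drop ((e.length - n) / 2)).take (n + (e.length - n) % 2)

theorem center_factorAt (i n k : ℕ) :
    center n (factorAt u i (n + k)) = factorAt u (i + k / 2) (n + k % 2) := by
  rw [center, length_factorAt, Nat.add_sub_cancel_left, drop_factorAt u i (by omega),
    take_factorAt u _ (by omega)]

/-- A palindromic directed edge has in its center a palindrome of length `n + 1` or a palindrome of
length `n` that is not special, and it is determined by this palindrome. -/
theorem bijOn_center [Finite A] (hG : ClosedUnder u G) (hN : IsDistinguishing u G N) {n : ℕ}
    (hn : N ≤ n) (hS : (specialFactors u n).Nonempty) :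
    Set.BijOn (center n) {e ∈ directedEdges u n | G.IsPalindrome e}
      ({w ∈ palindromes u G n | ¬ IsSpecial u w} ∪ palindromes u G (n + 1)) := by
  refine ⟨?_, ?_, ?_⟩
  · rintro e ⟨he, Θ, hΘ, hp⟩
    obtain ⟨i, k, hk, rfl, -, -, hi⟩ := mem_directedEdges_iff.1 he
    have hc : G.IsPalindrome (center n (factorAt u i (n + k))) := by
      refine ⟨Θ, hΘ, ?_⟩
      rw [center, length_factorAt, Nat.add_sub_cancel_left,
        apply_infix hΘ _ (by rw [length_factorAt]; omega), hp, length_factorAt,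
        show n + k - k / 2 - (n + k % 2) = k / 2 by omega]
    rw [center_factorAt] at hc ⊢
    rcases Nat.mod_two_eq_zero_or_one k with h | h <;> rw [h] at hc ⊢
    · exact Or.inl ⟨⟨factorAt_mem_factors u _ _, hc⟩, hi _ (by omega) (by omega)⟩
    · exact Or.inr ⟨factorAt_mem_factors u _ _, hc⟩
  · rintro e ⟨he, Θ, hΘ, hp⟩ e' ⟨he', Θ', hΘ', hp'⟩ h
    obtain ⟨i, k, hk, rfl, -, ht, hi⟩ := mem_directedEdges_iff.1 he
    obtain ⟨j, l, hl, rfl, -, ht', hj⟩ := mem_directedEdges_iff.1 he'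
    have hfix : ∀ {i k : ℕ} {Θ : Equiv.Perm (List A)}, Θ ∈ G.antimorphisms →
        Θ (factorAt u i (n + k)) = factorAt u i (n + k) →
        Θ (factorAt u (i + k / 2) (n + k % 2)) = factorAt u (i + k / 2) (n + k % 2) := by
      intro i k Θ hΘ hp
      rw [← center_factorAt, center, length_factorAt, Nat.add_sub_cancel_left,
        apply_infix hΘ _ (by rw [length_factorAt]; omega), hp, length_factorAt,
        show n + k - k / 2 - (n + k % 2) = k / 2 by omega]
    have hc := hfix hΘ hp
    have hc' := hfix hΘ' hp'
    rw [center_factorAt, center_factorAt] at h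
    rw [← h] at hc'
    -- Both edges are fixed by the antimorphism that fixes the common center.
    obtain rfl := antimorphism_ext hN (factorAt_mem u _ _) (by rw [length_factorAt]; omega)
      hΘ hΘ' (hc.trans hc'.symm)
    have hmod : k % 2 = l % 2 := by
      have := congrArg List.length h
      rw [length_factorAt, length_factorAt] at this
      omega
    have hone : factorAt u (i + k / 2) (n + 1) = factorAt u (j + l / 2) (n + 1) := by
      rw [← hmod] at h
      rcases Nat.mod_two_eq_zero_or_one k with h0 | h0 <;> rw [h0] at h
      · exact factorAt_succ_eq (hi _ (by omega) (by omega)) h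
      · exact h
    obtain ⟨h1, h2⟩ := factorAt_eq_of_next_special (k := k - k / 2) (l := l - l / 2)
      (by omega) (by omega) hone
      (fun t h0 h1 => by rw [add_assoc]; exact hi _ (by omega) (by omega))
      (by rwa [show i + k / 2 + (k - k / 2) = i + k by omega])
      (fun t h0 h1 => by rw [add_assoc]; exact hj _ (by omega) (by omega))
      (by rwa [show j + l / 2 + (l - l / 2) = j + l by omega])
    obtain rfl : k = l := by omega
    refine eq_of_drop_eq hΘ (a := k / 2) (by simp) (by rw [length_factorAt]; omega) ?_
      (Or.inl ⟨hp, hp'⟩)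
    rwa [drop_factorAt u i (by omega), drop_factorAt u j (by omega),
      show n + k - k / 2 = n + (k - k / 2) by omega]
  · intro c hc
    -- The palindrome `c` has length `n + r`.
    obtain ⟨r, hr, hcL, Θ, hΘ, hp, hns⟩ : ∃ r < 2, c ∈ factors u (n + r) ∧
        ∃ Θ ∈ G.antimorphisms, Θ c = c ∧ (r = 0 → ¬ IsSpecial u c) := by
      rcases hc with ⟨⟨hc, Θ, hΘ, h⟩, hs⟩ | ⟨hc, Θ, hΘ, h⟩
      · exact ⟨0, by omega, hc, Θ, hΘ, h, fun _ => hs⟩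
      · exact ⟨1, by omega, hc, Θ, hΘ, h, fun h => absurd h (by omega)⟩
    obtain ⟨p, hps, hpc⟩ : ∃ p, (∃ j ≤ p, IsSpecial u (factorAt u j n)) ∧
        factorAt u p (n + r) = c := by
      obtain ⟨w, hw, hws⟩ := hS
      obtain ⟨j, rfl⟩ := exists_factorAt_of_mem_factors hw
      obtain ⟨p, hp, hpc⟩ := exists_ge_factorAt_of_mem hG hcL.1 j
      exact ⟨p, ⟨j, hp, hws⟩, by rwa [hcL.2] at hpc⟩
    obtain ⟨s, hsp, hs, hs'⟩ := exists_previous_special hps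
    obtain ⟨k, hk, hkp, hk'⟩ := exists_next_special hG hS p
    have hs0 : r = 0 → 1 ≤ s := by
      rintro rfl
      by_contra h
      obtain rfl : s = 0 := by omega
      exact hns rfl (hpc ▸ hs)
    set e := factorAt u (p - s) (n + (s + k)) with he
    have heD : e ∈ directedEdges u n := by
      refine mem_directedEdges_iff.2 ⟨p - s, s + k, by omega, rfl, hs, ?_, fun t h0 h1 => ?_⟩
      · rwa [show p - s + (s + k) = p + k by omega]
      · rcases le_or_gt t s with h | h
        · rw [show p - s + t = p - (s - t) by omega]
          exact hs' _ (by omega)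
        · rw [show p - s + t = p + (t - s) by omega]
          exact hk' _ (by omega) (by omega)
    -- The image of the edge also contains `c`, at the mirror image of the position in the edge;
    -- since the continuation of `c` is unique, both positions coincide.
    obtain ⟨j, l, hl, hje, -, hjl, hj⟩ :=
      mem_directedEdges_iff.1 (apply_mem_directedEdges hG hΘ.1 heD)
    obtain rfl : l = s + k := by
      have := congrArg List.length hje
      rw [length_apply G hΘ.1, he, length_factorAt, length_factorAt] at this
      omega
    have hec : (e.drop s).take (n + r) = c := by
      rw [he, drop_factorAt u _ (by omega), take_factorAt u _ (by omega),
        show p - s + s = p by omega, hpc]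
    have hjc : factorAt u (j + (s + k - s - r)) (n + r) = c := by
      have := apply_infix hΘ e (a := s) (b := n + r) (by rw [he, length_factorAt]; omega)
      rw [hec, hp, hje, drop_factorAt u _ (by rw [he, length_factorAt]; omega),
        take_factorAt u _ (by rw [he, length_factorAt]; omega), he, length_factorAt] at this
      rw [this]
      congr 2
      omega
    have hone : factorAt u p (n + 1) = factorAt u (j + (s + k - s - r)) (n + 1) := by
      have h := hpc.trans hjc.symm
      obtain rfl | rfl : r = 0 ∨ r = 1 := by omega
      · exact factorAt_succ_eq (hpc.symm ▸ hns rfl) h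
      · exact h
    obtain ⟨h1, h2⟩ := factorAt_eq_of_next_special (k := k) (l := s + r) hk (by omega) hone hk' hkp
      (fun t h0 h1 => by rw [add_assoc]; exact hj _ (by omega) (by omega))
      (by rwa [show j + (s + k - s - r) + (s + r) = j + (s + k) by omega])
    have hfix : Θ e = e := by
      refine (eq_of_drop_eq hΘ (a := s) (length_apply G hΘ.1 e).symm
        (by rw [he, length_factorAt]; omega) ?_ (Or.inr ⟨rfl, ?_⟩)).symm
      · rw [hje, he, drop_factorAt u _ (by omega), drop_factorAt u _ (by omega),
          show p - s + s = p by omega, show n + (s + k) - s = n + k by omega, h2]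
        congr 2
        omega
      · exact Equiv.Perm.ext_iff.1
          (mul_self_of_apply_eq hN hcL.1 (by rw [hcL.2]; omega) hΘ hp) e
    refine ⟨e, ⟨heD, Θ, hΘ, hfix⟩, ?_⟩
    rw [he, center_factorAt, show (s + k) / 2 = s by omega, show (s + k) % 2 = r by omega,
      show p - s + s = p by omega, hpc]

theorem ncard_palindromic_directedEdges_add [Finite A] (hG : ClosedUnder u G)
    (hN : IsDistinguishing u G N) {n : ℕ} (hn : N ≤ n) (hS : (specialFactors u n).Nonempty) :
    {e ∈ directedEdges u n | G.IsPalindrome e}.ncard +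
        {w ∈ specialFactors u n | G.IsPalindrome w}.ncard
      = (palindromes u G n).ncard + (palindromes u G (n + 1)).ncard := by
  have hfin : ∀ m, (palindromes u G m).Finite :=
    fun m => (finite_factors m).subset (Set.sep_subset _ _)
  have h1 := (bijOn_center hG hN hn hS).ncard_eq
  rw [Set.ncard_union_eq _ ((hfin n).subset (Set.sep_subset _ _)) (hfin (n + 1))] at h1
  · have h2 := ncard_sep_not_add (hfin n) (IsSpecial u)
    have h3 : {w ∈ specialFactors u n | G.IsPalindrome w}
        = {w ∈ palindromes u G n | IsSpecial u w} := by
      ext w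
      simp only [specialFactors, palindromes, Set.mem_ofPred_eq]
      tauto
    rw [h3]
    omega
  · refine Set.disjoint_left.2 fun w hw hw' => ?_
    have h1 := hw.1.1.2
    have h2 := hw'.1.2
    omega

/-- In terms of the graph of symmetries, a balanced order is one in which there is one vertex more
than there are edges that are not palindromic. -/
theorem isBalanced_iff_ncard_orbits [Finite A] [Nontrivial A] (hG : ClosedUnder u G)
    (hN : IsDistinguishing u G N) {n : ℕ} (hn : N ≤ n) (hS : (specialFactors u n).Nonempty) :
    IsBalanced u G n ↔ (G.orbit '' specialFactors u n).ncard =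
      (G.orbit '' {e ∈ directedEdges u n | ¬ G.IsPalindrome e}).ncard + 1 := by
  have hSfin : (specialFactors u n).Finite := (finite_factors n).subset (Set.sep_subset _ _)
  have h1 := card_mul_ncard_orbits hN hSfin
    (fun w hw μ hμ => ⟨apply_mem_factors hG hw.1 hμ, hw.2.apply hG hμ⟩)
    fun w hw => ⟨hw.1.1, hw.1.2.symm ▸ hn⟩
  have h2 := card_mul_ncard_orbits_not_isPalindrome hN (finite_directedEdges hG n)
    (fun e he μ hμ => apply_mem_directedEdges hG hμ he)
    fun e he => ⟨he.1, by have := he.2.1; omega⟩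
  have h3 := ncard_sep_not_add (finite_directedEdges hG n) G.IsPalindrome
  have h4 := ncard_directedEdges_add hG n
  have h5 := ncard_palindromic_directedEdges_add hG hN hn hS
  rw [← Nat.mul_right_inj (card_pos G).ne', mul_add, mul_one, h1, h2, IsBalanced, deltaComplexity]
  omega

end DirectedEdges

/-! ### Multigraph trees and the number of edges -/

section Multigraph

variable {α β : Type*} {Γ : Graph α β}

open scoped Graph

/-- The edges of a multigraph without loops map onto those of its simple graph, and parallel edges
are those with the same image. -/
theorem exists_ends (Γ : Graph α β) [Γ.Loopless] :
    ∃ f : E(Γ) → Γ.toSimpleGraph.edgeSet, Function.Surjective f ∧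
      ∀ e e', f e = f e' ↔ ∃ x y, Γ.IsLink e x y ∧ Γ.IsLink e' x y := by
  have hex : ∀ e : E(Γ), ∃ x y : V(Γ), Γ.IsLink e x y := by
    rintro ⟨e, he⟩
    obtain ⟨x, y, h⟩ := Γ.exists_isLink_of_mem_edgeSet he
    exact ⟨⟨x, h.left_mem⟩, ⟨y, h.right_mem⟩, h⟩
  choose x y hxy using hex
  have hadj : ∀ e, s(x e, y e) ∈ Γ.toSimpleGraph.edgeSet := fun e =>
    SimpleGraph.mem_edgeSet _ |>.2 <| (Γ.toSimpleGraph_adj_iff _ _).2 ⟨e, hxy e⟩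
  refine ⟨fun e => ⟨s(x e, y e), hadj e⟩, ?_, fun e e' => ?_⟩
  · rintro ⟨p, hp⟩
    induction p using Sym2.ind with
    | _ a b =>
      obtain ⟨e, he⟩ := (Γ.toSimpleGraph_adj_iff _ _).1 hp
      refine ⟨⟨e, he.edge_mem⟩, Subtype.ext ?_⟩
      rcases (hxy ⟨e, he.edge_mem⟩).eq_and_eq_or_eq_and_eq he with ⟨h1, h2⟩ | ⟨h1, h2⟩
      · exact Sym2.eq_iff.2 (Or.inl ⟨Subtype.ext h1, Subtype.ext h2⟩)
      · exact Sym2.eq_iff.2 (Or.inr ⟨Subtype.ext h1, Subtype.ext h2⟩)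
  · rw [Subtype.ext_iff, Sym2.eq_iff]
    constructor
    · rintro (⟨h1, h2⟩ | ⟨h1, h2⟩)
      · exact ⟨_, _, hxy e, by rw [h1, h2]; exact hxy e'⟩
      · exact ⟨_, _, hxy e, by rw [h1, h2]; exact (hxy e').symm⟩
    · rintro ⟨a, b, h, h'⟩
      have h1 := (hxy e).eq_and_eq_or_eq_and_eq h
      have h2 := (hxy e').eq_and_eq_or_eq_and_eq h'
      simp only [Subtype.ext_iff]
      grind

theorem ncard_vertexSet_le [Γ.Loopless] (hE : E(Γ).Finite)
    (hconn : Γ.toSimpleGraph.Connected) : V(Γ).ncard ≤ E(Γ).ncard + 1 := by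
  obtain ⟨f, hf, -⟩ := exists_ends Γ
  have := hE.to_subtype
  exact hconn.card_vert_le_card_edgeSet_add_one.trans
    (Nat.add_le_add_right (Nat.card_le_card_of_surjective f hf) 1)

/-- A finite connected multigraph without loops is a tree if and only if it has one vertex more
than it has edges. -/
theorem isMultigraphTree_iff [Γ.Loopless] (hV : V(Γ).Finite) (hE : E(Γ).Finite)
    (hconn : Γ.toSimpleGraph.Connected) :
    IsMultigraphTree Γ ↔ V(Γ).ncard = E(Γ).ncard + 1 := by
  obtain ⟨f, hf, hff⟩ := exists_ends Γ
  have := hV.to_subtype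
  have := hE.to_subtype
  have htree := SimpleGraph.isTree_iff_connected_and_card (G := Γ.toSimpleGraph)
  constructor
  · rintro ⟨hs, -, hac⟩
    have hinj : Function.Injective f := by
      intro e e' h
      obtain ⟨x, y, h1, h2⟩ := (hff e e').1 h
      exact Subtype.ext (h1.eq h2)
    have h1 := (htree.1 ⟨hconn, hac⟩).2
    rw [← Nat.card_congr (Equiv.ofBijective f ⟨hinj, hf⟩)] at h1
    exact h1.symm
  · intro h
    have h1 := hconn.card_vert_le_card_edgeSet_add_one
    have h2 := Nat.card_le_card_of_surjective f hf
    have h3 : Nat.card V(Γ) = Nat.card E(Γ) + 1 := h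
    have h4 : Nat.card E(Γ) = Nat.card Γ.toSimpleGraph.edgeSet := by omega
    have hbij : Function.Bijective f := (Nat.bijective_iff_surjective_and_card f).2 ⟨hf, h4⟩
    refine ⟨⟨fun e e' x y he he' => ?_⟩, hconn.preconnected, (htree.2 ⟨hconn, by omega⟩).isAcyclic⟩
    exact congrArg Subtype.val (hbij.1
      ((hff ⟨e, he.edge_mem⟩ ⟨e', he'.edge_mem⟩).2 ⟨x, y, he, he'⟩))

end Multigraph

/-! ### The graph of symmetries -/

section GraphOfSymmetries

variable {A : Type*} {G : SymmetryGroup A} {u : ℕ → A} {N : ℕ}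

open scoped Graph

/-- The graph of symmetries without its loops. -/
def looplessSymmetriesGraph (G : SymmetryGroup A) (u : ℕ → A) (n : ℕ) :
    Graph (Set (List A)) (Set (List A)) :=
  (symmetriesGraph G u n).deleteEdges (loops (symmetriesGraph G u n))

theorem vertexSet_looplessSymmetriesGraph (n : ℕ) :
    V(looplessSymmetriesGraph G u n) = G.orbit '' specialFactors u n := by
  ext x
  constructor
  · rintro ⟨w, hl, hs, rfl⟩
    exact ⟨w, ⟨⟨hs.mem_language, hl⟩, hs⟩, rfl⟩
  · rintro ⟨w, hw, rfl⟩
    exact ⟨w, hw.1.2, hw.2, rfl⟩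

theorem isLink_looplessSymmetriesGraph_iff {n : ℕ} {E x y : Set (List A)} :
    (looplessSymmetriesGraph G u n).IsLink E x y ↔
      (symmetriesGraph G u n).IsLink E x y ∧ E ∉ loops (symmetriesGraph G u n) := by
  rw [looplessSymmetriesGraph, Graph.deleteEdges_isLink]

theorem isLink_orbit {n : ℕ} {e : List A} (he : e ∈ directedEdges u n) :
    (symmetriesGraph G u n).IsLink (G.orbit e) (source G n e) (target G n e) :=
  ⟨e, he, rfl, Or.inl ⟨rfl, rfl⟩⟩

theorem orbit_mem_loops_iff {n : ℕ} {e : List A} (he : e ∈ directedEdges u n) :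
    G.orbit e ∈ loops (symmetriesGraph G u n) ↔ source G n e = target G n e := by
  constructor
  · rintro ⟨x, hx⟩
    rcases (isLink_orbit he).eq_and_eq_or_eq_and_eq hx with ⟨h1, h2⟩ | ⟨h1, h2⟩ <;>
      exact h1.trans h2.symm
  · exact fun h => ⟨source G n e, by
      have := isLink_orbit (G := G) he
      rwa [← h] at this⟩

instance (n : ℕ) : (looplessSymmetriesGraph G u n).Loopless :=
  ⟨fun _ x h => (isLink_looplessSymmetriesGraph_iff.1 h).2
    ⟨x, (isLink_looplessSymmetriesGraph_iff.1 h).1⟩⟩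

theorem edgeSet_looplessSymmetriesGraph (n : ℕ) :
    E(looplessSymmetriesGraph G u n) =
      G.orbit '' {e ∈ directedEdges u n | source G n e ≠ target G n e} := by
  ext E
  constructor
  · intro hE
    obtain ⟨x, y, h⟩ := Graph.exists_isLink_of_mem_edgeSet hE
    obtain ⟨⟨e, he, rfl, -⟩, h2⟩ := isLink_looplessSymmetriesGraph_iff.1 h
    exact ⟨e, ⟨he, fun h => h2 ((orbit_mem_loops_iff he).2 h)⟩, rfl⟩
  · rintro ⟨e, ⟨he, h⟩, rfl⟩
    exact (isLink_looplessSymmetriesGraph_iff.2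
      ⟨isLink_orbit he, fun h' => h ((orbit_mem_loops_iff he).1 h')⟩).edge_mem

theorem orbit_mem_vertexSet {n i : ℕ} (h : IsSpecial u (factorAt u i n)) :
    G.orbit (factorAt u i n) ∈ V(looplessSymmetriesGraph G u n) := by
  rw [vertexSet_looplessSymmetriesGraph]
  exact ⟨_, ⟨factorAt_mem_factors u i n, h⟩, rfl⟩

/-- The word itself is a walk that visits all special factors. -/
theorem reachable_orbit {n : ℕ} (k : ℕ) : ∀ (i : ℕ) (hi : IsSpecial u (factorAt u i n))
    (hk : IsSpecial u (factorAt u (i + k) n)),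
    (looplessSymmetriesGraph G u n).toSimpleGraph.Reachable
      ⟨_, orbit_mem_vertexSet hi⟩ ⟨_, orbit_mem_vertexSet hk⟩ := by
  classical
  induction k using Nat.strong_induction_on with
  | _ k ih =>
    intro i hi hk
    rcases Nat.eq_zero_or_pos k with rfl | hpos
    · exact SimpleGraph.Reachable.refl _
    · have hex : ∃ t, 0 < t ∧ IsSpecial u (factorAt u (i + t) n) := ⟨k, hpos, hk⟩
      obtain ⟨ht0, hts⟩ := Nat.find_spec hex
      have htk : Nat.find hex ≤ k := Nat.find_min' hex ⟨hpos, hk⟩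
      have hmin : ∀ t, 0 < t → t < Nat.find hex → ¬ IsSpecial u (factorAt u (i + t) n) :=
        fun t h0 h1 h2 => Nat.find_min hex h1 ⟨h0, h2⟩
      generalize Nat.find hex = t at ht0 hts htk hmin
      obtain ⟨l, rfl⟩ := Nat.exists_eq_add_of_le htk
      have h2 := ih l (by omega) (i + t) hts (by rwa [add_assoc])
      have he : factorAt u i (n + t) ∈ directedEdges u n :=
        mem_directedEdges_iff.2 ⟨i, t, ht0, rfl, hi, hts, hmin⟩
      have h1 : (looplessSymmetriesGraph G u n).toSimpleGraph.Reachable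
          ⟨_, orbit_mem_vertexSet hi⟩ ⟨_, orbit_mem_vertexSet hts⟩ := by
        by_cases h : G.orbit (factorAt u i n) = G.orbit (factorAt u (i + t) n)
        · have : (⟨_, orbit_mem_vertexSet hi⟩ : V(looplessSymmetriesGraph G u n)) =
              ⟨_, orbit_mem_vertexSet hts⟩ := Subtype.ext h
          rw [this]
        · refine SimpleGraph.Adj.reachable ((Graph.toSimpleGraph_adj_iff _ _).2
            ⟨G.orbit (factorAt u i (n + t)), isLink_looplessSymmetriesGraph_iff.2 ⟨?_, ?_⟩⟩)
          · have := isLink_orbit (G := G) he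
            rwa [source_factorAt, target_factorAt] at this
          · rwa [orbit_mem_loops_iff he, source_factorAt, target_factorAt]
      have h3 := h1.trans h2
      convert h3 using 4
      rw [add_assoc]

theorem connected_looplessSymmetriesGraph {n : ℕ} (hS : (specialFactors u n).Nonempty) :
    (looplessSymmetriesGraph G u n).toSimpleGraph.Connected := by
  have hpos : ∀ x : V(looplessSymmetriesGraph G u n), ∃ (i : ℕ)
      (hi : IsSpecial u (factorAt u i n)), x = ⟨_, orbit_mem_vertexSet hi⟩ := by
    rintro ⟨x, hx⟩
    have hx' := hx
    rw [vertexSet_looplessSymmetriesGraph] at hx'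
    obtain ⟨w, ⟨hw, hs⟩, rfl⟩ := hx'
    obtain ⟨i, rfl⟩ := exists_factorAt_of_mem_factors hw
    exact ⟨i, hs, rfl⟩
  have : Nonempty V(looplessSymmetriesGraph G u n) := by
    obtain ⟨w, hw⟩ := hS
    exact ⟨⟨G.orbit w, by rw [vertexSet_looplessSymmetriesGraph]; exact ⟨w, hw, rfl⟩⟩⟩
  refine ⟨fun x y => ?_⟩
  obtain ⟨i, hi, rfl⟩ := hpos x
  obtain ⟨j, hj, rfl⟩ := hpos y
  rcases le_total i j with h | h <;> obtain ⟨k, rfl⟩ := Nat.exists_eq_add_of_le h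
  · exact reachable_orbit k i hi hj
  · exact (reachable_orbit k j hj hi).symm

/-- The conditions on the graph of symmetries of order `n` in the tree-like structure. -/
def IsTreeLike (G : SymmetryGroup A) (u : ℕ → A) (n : ℕ) : Prop :=
  (∀ e ∈ directedEdges u n, G.orbit e ∈ loops (symmetriesGraph G u n) → G.IsPalindrome e) ∧
    IsMultigraphTree (looplessSymmetriesGraph G u n)

/-- Palindromic edges are loops and the graph is connected, so there are at least as many
non-palindromic edges as in a tree, and equality means that they form a tree. -/
theorem isTreeLike_iff_isBalanced_of_nonempty [Finite A] [Nontrivial A] (hG : ClosedUnder u G)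
    (hN : IsDistinguishing u G N) {n : ℕ} (hn : N ≤ n) (hS : (specialFactors u n).Nonempty) :
    IsTreeLike G u n ↔ IsBalanced u G n := by
  rw [isBalanced_iff_ncard_orbits hG hN hn hS]
  have hD := finite_directedEdges hG (u := u) n
  have hV : V(looplessSymmetriesGraph G u n).Finite := by
    rw [vertexSet_looplessSymmetriesGraph]
    exact ((finite_factors n).subset (Set.sep_subset _ _)).image _
  have hE : E(looplessSymmetriesGraph G u n).Finite := by
    rw [edgeSet_looplessSymmetriesGraph]
    exact (hD.subset (Set.sep_subset _ _)).image _
  have hconn := connected_looplessSymmetriesGraph (G := G) hS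
  have htree := isMultigraphTree_iff hV hE hconn
  have hle := ncard_vertexSet_le hE hconn
  set X := G.orbit '' {e ∈ directedEdges u n | ¬ G.IsPalindrome e} with hX
  have hXfin : X.Finite := (hD.subset (Set.sep_subset _ _)).image _
  have hEX : E(looplessSymmetriesGraph G u n) ⊆ X := by
    rw [edgeSet_looplessSymmetriesGraph]
    refine Set.image_mono fun e he => ⟨he.1, fun hp => he.2 ?_⟩
    exact source_eq_target_of_isPalindrome hp (by have := he.1.2.1; omega)
  have hloop : (∀ e ∈ directedEdges u n,
      G.orbit e ∈ loops (symmetriesGraph G u n) → G.IsPalindrome e) ↔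
      X ⊆ E(looplessSymmetriesGraph G u n) := by
    rw [edgeSet_looplessSymmetriesGraph]
    constructor
    · rintro h _ ⟨e, he, rfl⟩
      exact ⟨e, ⟨he.1, fun h' => he.2 (h e he.1 ((orbit_mem_loops_iff he.1).2 h'))⟩, rfl⟩
    · intro h e he hl
      by_contra hp
      obtain ⟨e', he', heq⟩ := h ⟨e, ⟨he, hp⟩, rfl⟩
      exact he'.2 ((orbit_mem_loops_iff he'.1).1 (heq.symm ▸ hl))
  rw [IsTreeLike, htree, hloop, vertexSet_looplessSymmetriesGraph]
  rw [vertexSet_looplessSymmetriesGraph] at hle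
  constructor
  · rintro ⟨h1, h2⟩
    rw [h2, Set.Subset.antisymm hEX h1]
  · intro h
    have h1 := Set.eq_of_subset_of_ncard_le hEX (by omega) hXfin
    exact ⟨h1.ge, by rw [h, h1]⟩

/-- Without special factors the graph of symmetries is empty. -/
theorem isTreeLike_of_specialFactors_eq_empty {n : ℕ} (hS : specialFactors u n = ∅) :
    IsTreeLike G u n := by
  have hD : ∀ e, e ∉ directedEdges u n := by
    intro e he
    obtain ⟨i, k, -, -, hs, -⟩ := mem_directedEdges_iff.1 he
    exact Set.eq_empty_iff_forall_notMem.1 hS _ ⟨factorAt_mem_factors u i n, hs⟩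
  have hV : IsEmpty V(looplessSymmetriesGraph G u n) := by
    rw [vertexSet_looplessSymmetriesGraph, hS, Set.image_empty]
    infer_instance
  refine ⟨fun e he => absurd he (hD e), ⟨fun E E' x y h _ => ?_⟩, fun x => isEmptyElim x, ?_⟩
  · obtain ⟨⟨e, he, -⟩, -⟩ := isLink_looplessSymmetriesGraph_iff.1 h
    exact absurd he (hD e)
  · exact fun x => isEmptyElim x

/-! ### Periodic words -/

/-- If no factor of length `n` is special, the predecessor of each of them is unique. -/
theorem factorAt_pred_eq [Finite A] {n : ℕ} (hS : specialFactors u n = ∅) {p q : ℕ}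
    (h : factorAt u (p + 1) n = factorAt u (q + 1) n) :
    factorAt u p (n + 1) = factorAt u q (n + 1) := by
  have h1 := factorAt_mem u p (n + 1)
  have h2 := factorAt_mem u q (n + 1)
  rw [factorAt_succ'] at h1 h2
  rw [← h] at h2
  have hns : ¬ IsSpecial u (factorAt u (p + 1) n) := fun hs =>
    Set.eq_empty_iff_forall_notMem.1 hS _ ⟨factorAt_mem_factors u _ n, hs⟩
  rw [factorAt_succ', factorAt_succ', ← h, eq_of_cons_mem hns h1 h2]

theorem factorAt_eq_of_add [Finite A] {n : ℕ} (hS : specialFactors u n = ∅) {p q : ℕ} (t : ℕ)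
    (h : factorAt u (p + t) n = factorAt u (q + t) n) :
    factorAt u p n = factorAt u q n := by
  induction t with
  | zero => exact h
  | succ t ih =>
    have h1 := congrArg (List.take n) (factorAt_pred_eq hS (p := p + t) (q := q + t) h)
    rw [take_factorAt u _ (by omega), take_factorAt u _ (by omega)] at h1
    exact ih h1

/-- An antimorphism acts on a periodic word as a reflection. -/
theorem apply_factorAt_reflect [Finite A] (hG : ClosedUnder u G) {n : ℕ}
    (hS : specialFactors u n = ∅) {Θ : Equiv.Perm (List A)} (hΘ : Θ ∈ G.antimorphisms) {i j : ℕ}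
    (h : Θ (factorAt u i n) = factorAt u j n) (t : ℕ) (ht : t ≤ j) :
    Θ (factorAt u (i + t) n) = factorAt u (j - t) n ∧
      (t < j → Θ (factorAt u (i + t) (n + 1)) = factorAt u (j - t - 1) (n + 1)) := by
  have step : ∀ {p q}, Θ (factorAt u p n) = factorAt u (q + 1) n →
      Θ (factorAt u p (n + 1)) = factorAt u q (n + 1) := by
    intro p q hpq
    obtain ⟨l, hl⟩ := exists_factorAt_of_mem_factors
      (apply_mem_factors hG (factorAt_mem_factors u p (n + 1)) hΘ.1)
    rw [← hl]
    refine factorAt_pred_eq hS ?_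
    have h1 := congrArg (List.drop 1) hl
    rw [drop_factorAt u l (by omega), drop_apply_of_isAntimorphism hΘ.1 hΘ.2 _ (by simp),
      length_factorAt, Nat.add_sub_cancel, take_factorAt u p (by omega), hpq] at h1
    exact h1
  have main : ∀ t ≤ j, Θ (factorAt u (i + t) n) = factorAt u (j - t) n := by
    intro t
    induction t with
    | zero => exact fun _ => h
    | succ t ih =>
      intro ht
      have h1 := ih (by omega)
      rw [show j - t = j - (t + 1) + 1 by omega] at h1
      have h2 := congrArg (List.take n) (step h1)
      rw [take_apply_of_isAntimorphism hΘ.1 hΘ.2 _ (by simp), length_factorAt,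
        Nat.add_sub_cancel_left, drop_factorAt u _ (by omega), take_factorAt u _ (by omega)] at h2
      exact h2
  refine ⟨main t ht, fun htj => step ?_⟩
  rw [main t ht, show j - t - 1 + 1 = j - t by omega]

/-- In a periodic word, each antimorphism is a reflection of the cycle of the factors of length `n`,
with two fixed points among the vertices and the edges of the cycle. -/
theorem two_le_palindromicComplexity [Finite A] (hG : ClosedUnder u G) {n : ℕ}
    (hS : specialFactors u n = ∅) {Θ : Equiv.Perm (List A)} (hΘ : Θ ∈ G.antimorphisms) :
    2 ≤ palindromicComplexity u Θ n + palindromicComplexity u Θ (n + 1) := by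
  classical
  have hfin : ∀ m, {w | w ∈ factors u m ∧ Θ w = w}.Finite :=
    fun m => (finite_factors m).subset (Set.sep_subset _ _)
  have hper : ∃ P, 0 < P ∧ factorAt u P n = factorAt u 0 n := by
    obtain ⟨j, hj, h⟩ := exists_ge_factorAt_eq (u := u) hG 0 n 1
    exact ⟨j, hj, h⟩
  obtain ⟨hP0, hP⟩ := Nat.find_spec hper
  have hmin : ∀ t, 0 < t → t < Nat.find hper → factorAt u t n ≠ factorAt u 0 n :=
    fun t h0 h1 h2 => Nat.find_min hper h1 ⟨h0, h2⟩
  generalize Nat.find hper = P at hP0 hP hmin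
  obtain ⟨j, hj⟩ := exists_factorAt_of_mem_factors
    (apply_mem_factors hG (factorAt_mem_factors u 0 n) hΘ.1)
  have hPadd : ∀ t, factorAt u (P + t) n = factorAt u t n := by
    intro t
    induction t with
    | zero => exact hP
    | succ t ih =>
      have hns : ¬ IsSpecial u (factorAt u (P + t) n) := fun hs =>
        Set.eq_empty_iff_forall_notMem.1 hS _ ⟨factorAt_mem_factors u _ n, hs⟩
      have h1 := congrArg (List.drop 1) (factorAt_succ_eq hns ih)
      rw [drop_factorAt u _ (by omega), drop_factorAt u _ (by omega)] at h1
      exact h1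
  have hj' : Θ (factorAt u 0 n) = factorAt u (P + j) n := by rw [hPadd, hj]
  have hne : ∀ t q, 0 < q → q < P → factorAt u t n ≠ factorAt u (t + q) n := by
    intro t q h0 h1 h2
    refine hmin q h0 h1 (factorAt_eq_of_add hS t ?_)
    rw [zero_add, add_comm q t, h2]
  -- The fixed points are at the half-integral positions `j / 2` and `(P + j) / 2`.
  have heven : ∀ {l t}, Θ (factorAt u 0 n) = factorAt u l n → l = 2 * t →
      factorAt u t n ∈ {w | w ∈ factors u n ∧ Θ w = w} := by
    rintro l t hl rfl
    have h1 := (apply_factorAt_reflect hG hS hΘ hl t (by omega)).1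
    rw [zero_add, show 2 * t - t = t by omega] at h1
    exact ⟨factorAt_mem_factors u t n, h1⟩
  have hodd : ∀ {l t}, Θ (factorAt u 0 n) = factorAt u l n → l = 2 * t + 1 →
      factorAt u t (n + 1) ∈ {w | w ∈ factors u (n + 1) ∧ Θ w = w} := by
    rintro l t hl rfl
    have h1 := (apply_factorAt_reflect hG hS hΘ hl t (by omega)).2 (by omega)
    rw [zero_add, show 2 * t + 1 - t - 1 = t by omega] at h1
    exact ⟨factorAt_mem_factors u t (n + 1), h1⟩
  have hpos : ∀ {m x}, x ∈ {w | w ∈ factors u m ∧ Θ w = w} →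
      1 ≤ palindromicComplexity u Θ m := fun {m x} hx =>
    (Set.ncard_pos (hfin m)).2 ⟨x, hx⟩
  have htwo : ∀ {m x y}, x ∈ {w | w ∈ factors u m ∧ Θ w = w} →
      y ∈ {w | w ∈ factors u m ∧ Θ w = w} → x ≠ y → 2 ≤ palindromicComplexity u Θ m :=
    fun {m x y} hx hy hxy => (Set.one_lt_ncard_iff (hfin m)).2 ⟨x, y, hx, hy, hxy⟩
  rcases Nat.even_or_odd' j with ⟨t, ht | ht⟩ <;>
    rcases Nat.even_or_odd' (P + j) with ⟨s, hs | hs⟩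
  · have := htwo (heven hj.symm ht) (heven hj' hs) (by
      have := hne t (s - t) (by omega) (by omega)
      rwa [show t + (s - t) = s by omega] at this)
    omega
  · have h1 := hpos (heven hj.symm ht)
    have h2 := hpos (hodd hj' hs)
    omega
  · have h1 := hpos (hodd hj.symm ht)
    have h2 := hpos (heven hj' hs)
    omega
  · have := htwo (hodd hj.symm ht) (hodd hj' hs) (fun h => by
      have h1 := congrArg (List.take n) h
      rw [take_factorAt u _ (by omega), take_factorAt u _ (by omega)] at h1
      refine hne t (s - t) (by omega) (by omega) ?_
      rwa [show t + (s - t) = s by omega])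
    omega

theorem complexity_succ_of_specialFactors_eq_empty [Finite A] (hG : ClosedUnder u G) {n : ℕ}
    (hS : specialFactors u n = ∅) : complexity u (n + 1) = complexity u n := by
  have h1 := ncard_directedEdges_add hG (u := u) n
  have h2 : directedEdges u n = ∅ := by
    refine Set.eq_empty_of_forall_notMem fun e he => ?_
    obtain ⟨i, k, -, -, hs, -⟩ := mem_directedEdges_iff.1 he
    exact Set.eq_empty_iff_forall_notMem.1 hS _ ⟨factorAt_mem_factors u i n, hs⟩
  rw [h2, hS, Set.ncard_empty] at h1
  omega

theorem isBalanced_of_specialFactors_eq_empty [Finite A] [Nontrivial A] (hG : ClosedUnder u G)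
    (hN : IsDistinguishing u G N) {n : ℕ} (hn : N ≤ n) (hS : specialFactors u n = ∅) :
    IsBalanced u G n := by
  have h1 := ncard_palindromes_add_le hG hN hn
  have h2 := complexity_succ_of_specialFactors_eq_empty hG hS
  have hsub : G.involutiveAntimorphisms ⊆ G.antimorphisms := Set.sep_subset _ _
  have hfin := finite_antimorphisms G
  have h3 : 2 * G.antimorphisms.ncard ≤
      (palindromes u G n).ncard + (palindromes u G (n + 1)).ncard := by
    rw [← finsum_palindromicComplexity hN hn subset_rfl hsub,
      ← finsum_palindromicComplexity hN (hn.trans (Nat.le_succ n)) subset_rfl hsub,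
      ← finsum_mem_add_distrib hfin, finsum_mem_eq_finite_toFinset_sum _ hfin,
      Set.ncard_eq_toFinset_card _ hfin, mul_comm, ← smul_eq_mul]
    refine Finset.card_nsmul_le_sum _ _ _ fun Θ hΘ => ?_
    exact two_le_palindromicComplexity hG hS (hfin.mem_toFinset.1 hΘ)
  have h4 := (card_eq (G := G)).2
  rw [deltaComplexity, h2] at h1
  rw [IsBalanced, deltaComplexity, h2]
  omega

theorem isTreeLike_iff_isBalanced [Finite A] [Nontrivial A] (hG : ClosedUnder u G)
    (hN : IsDistinguishing u G N) {n : ℕ} (hn : N ≤ n) :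
    IsTreeLike G u n ↔ IsBalanced u G n := by
  rcases (specialFactors u n).eq_empty_or_nonempty with hS | hS
  · exact iff_of_true (isTreeLike_of_specialFactors_eq_empty hS)
      (isBalanced_of_specialFactors_eq_empty hG hN hn hS)
  · exact isTreeLike_iff_isBalanced_of_nonempty hG hN hn hS

end GraphOfSymmetries

end GRich

theorem mainTheorem5 {A : Type*} [Finite A] [Nontrivial A] (G : GRich.SymmetryGroup A)
    (u : ℕ → A) (hu : Function.Surjective u) (hG : GRich.ClosedUnder u G)
    (N : ℕ) (hN : GRich.IsDistinguishing u G N) :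
    GRich.HasTreeLikeStructure G u N ↔
      (∀ w : List A, GRich.IsBispecial u w → N ≤ w.length →
        (¬ G.IsPalindrome w → GRich.bilateralOrder u w = 0) ∧
        (∀ Θ ∈ G.antimorphisms, Θ w = w →
          GRich.bilateralOrder u w = ((GRich.Pext u Θ w).ncard : ℤ) - 1)) ∧
      GRich.deltaComplexity u N + (G.card : ℤ) =
        ∑ᶠ Θ ∈ G.involutiveAntimorphisms,
          ((GRich.palindromicComplexity u Θ N : ℤ) +
            GRich.palindromicComplexity u Θ (N + 1)) := by
  have h1 : GRich.HasTreeLikeStructure G u N ↔ ∀ n, N ≤ n → GRich.IsBalanced u G n :=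
    forall₂_congr fun n hn =>
      (and_iff_right hG).trans (GRich.isTreeLike_iff_isBalanced hG hN hn)
  rw [h1, GRich.forall_isBalanced_iff hG hN, GRich.isBalanced_iff_finsum hN]
  refine and_congr_left' ⟨fun h w hw hl => ?_, fun h w hw hl => ?_⟩
  · exact (GRich.bilateralExcess_eq_zero_iff hN hw.1.1 hl).1 (h w hw.1.1 hl)
  · by_cases hb : GRich.IsBispecial u w
    · exact (GRich.bilateralExcess_eq_zero_iff hN hw hl).2 (h w hb hl)
    · exact GRich.bilateralExcess_eq_zero_of_not_isBispecial hG hw hb
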